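/- **Setting.** Let $\hat T\subset\mathbb R^3$ be the tetrahedron with vertices $(1,1,1)$, $(1,-1,-1)$, $(-1,1,-1)$, $(-1,-1,1)$, whose edge midpoints are $\pm e_1,\pm e_2,\pm e_3$, and let $\hat V=\mathrm{span}(1,x_1,x_2,x_3,x_1^2-x_2^2,x_2^2-x_3^2)$. For a nondegenerate tetrahedron $T=F_T(\hat T)$, with $F_T$ affine, let $V(T)=\{v: v\circ F_T\in\hat V\}$. Let $\Omega\subset\mathbb R^3$ be a nonempty bounded open set and $\mathcal T_h$ a finite conforming tetrahedrization of $\Omega$: $\overline\Omega$ is the union of the closed tetrahedra $T\in\mathcal T_h$, different tetrahedra have disjoint interiors and meet in the (possibly empty) simplex spanned by their common vertices, and $\partial\Omega$ is the union of the faces that belong to exactly one tetrahedron. An edge is *interior* if it is not contained in $\partial\Omega$; $x_E$ is the midpoint of the edge $E$; $h_T$ is the diameter of $T$. Define - $W_h$: the vector fields $v$ on $\Omega$, possibly discontinuous across faces, such that on every $T$ each component of $v|_T$ is in $V(T)$, $v$ is continuous at $x_E$ for every interior edge $E$ (the values of $v|_T(x_E)$ agree for all $T$ containing $E$), and $v|_T(x_E)=0$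 for every edge $E\subset\partial\Omega$ and every $T$ containing $E$; - $Q_h$: the functions that are continuous on $\overline\Omega$, affine on each $T\in\mathcal T_h$ and of mean value zero over $\Omega$; - $b(v,q)=\sum_{T\in\mathcal T_h}\big((\nabla\cdot v,q)_T-(n\cdot v,q)_{\partial T}\big)$, with $n$ the unit normal pointing out of $T$, and $\|v\|_{a_h}=\big(\sum_{T\in\mathcal T_h}\|\nabla v\|_{L^2(T)}^2\big)^{1/2}$. **Lemma.** For all $\sigma,\kappa>0$ there is a constant $c_3>0$, depending only on $\sigma$ and $\kappa$, with the following property. Let $\Omega$ and $\mathcal T_h$ be as above, and assume that every $T\in\mathcal T_h$ contains a ball of radius $h_T/\sigma$ (shape regularity) and has at least three interior edges. Let $h>0$ satisfy $h\le\kappa h_T$ for all $T\in\mathcal T_h$ (for $h=\max_T h_T$ this is quasi-uniformity). Then $$\sup_{v\in W_h,\ \|v\|_{a_h}\ne0}\frac{b(v,q)}{\|v\|_{a_h}}\ \ge\ c_3\,h\,\|\nabla q\|_{L^2(\Omega)}\qquad\text{for all }q\in Q_h .$$ -/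

import Mathlib

open MeasureTheory

noncomputable section

namespace RotatedQ1

/-- Three-dimensional Euclidean space. -/
abbrev E3 : Type := EuclideanSpace ℝ (Fin 3)

/-! ### The reference element -/

/-- The vertices of the reference tetrahedron: it is inscribed in the cube `[-1,1]³`, its edges are
diagonals of the faces of the cube, and its edge midpoints are the points `±e₁, ±e₂, ±e₃`. -/
def refVertex : Fin 4 → E3 :=
  ![!₂[1, 1, 1], !₂[1, -1, -1], !₂[-1, 1, -1], !₂[-1, -1, 1]]

/-- The reference shape functions `span (1, x₁, x₂, x₃, x₁² - x₂², x₂² - x₃²)`. -/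
def refSpace : Submodule ℝ (E3 → ℝ) :=
  Submodule.span ℝ
    {fun _ => 1, fun x => x 0, fun x => x 1, fun x => x 2,
      fun x => x 0 ^ 2 - x 1 ^ 2, fun x => x 1 ^ 2 - x 2 ^ 2}

/-- A (nondegenerate) tetrahedron, given by its four affinely independent vertices. -/
abbrev Tet : Type := Affine.Simplex ℝ E3 3

/-- The closed solid tetrahedron. -/
def body (T : Tet) : Set E3 := convexHull ℝ (Set.range T.points)

/-- The affine map from the reference tetrahedron to `T`, taking vertex `j` to vertex `j`; note that
`(1 + ⟪refVertex j, x⟫) / 4` is the `j`-th barycentric coordinate on the reference tetrahedron. -/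
def refMap (T : Tet) (x : E3) : E3 :=
  ∑ j, ((1 + inner ℝ (refVertex j) x) / 4) • T.points j

/-- The shape functions on `T`: the functions `v` with `v ∘ F` in the reference space, for the affine
map `F` from the reference element. (Such a `v` is a polynomial, so it is determined by its
restriction to `T`, and we let it be defined on the whole space.) -/
def shapeSpace (T : Tet) : Set (E3 → ℝ) := {v | v ∘ refMap T ∈ refSpace}

/-! ### Integrals over the boundary of a tetrahedron -/

/-- Cross product in `E3`. -/
def cross (a b : E3) : E3 := WithLp.toLp 2 (crossProduct (WithLp.ofLp a) (WithLp.ofLp b))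

/-- The integral of `g` over the triangle with vertices `a, b, c` with respect to surface area. -/
def triangleIntegral (a b c : E3) (g : E3 → ℝ) : ℝ :=
  ‖cross (b - a) (c - a)‖ *
    ∫ s in (0 : ℝ)..1, ∫ t in (0 : ℝ)..(1 - s), g (a + s • (b - a) + t • (c - a))

/-- The `k`-th vertex (`k = 0, 1, 2`) of the face of `T` opposite to vertex `m`. -/
def faceVertex (T : Tet) (m : Fin 4) (k : Fin 3) : E3 := T.points (m.succAbove k)

/-- A normal vector to the face opposite to vertex `m`, of unspecified orientation and length. -/
def faceNormal (T : Tet) (m : Fin 4) : E3 :=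
  cross (faceVertex T m 1 - faceVertex T m 0) (faceVertex T m 2 - faceVertex T m 0)

/-- The unit normal to the face opposite to vertex `m` that points out of `T`, that is, away from
vertex `m`. -/
def outwardNormal (T : Tet) (m : Fin 4) : E3 :=
  (SignType.sign (inner ℝ (faceNormal T m) (faceVertex T m 0 - T.points m)) : ℝ) •
    (‖faceNormal T m‖⁻¹ • faceNormal T m)

/-- `(n · w, q)_{∂T}`, the sum over the four faces. -/
def boundaryFlux (T : Tet) (w : E3 → E3) (q : E3 → ℝ) : ℝ :=
  ∑ m, triangleIntegral (faceVertex T m 0) (faceVertex T m 1) (faceVertex T m 2)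
    (fun x => inner ℝ (outwardNormal T m) (w x) * q x)

/-! ### Meshes -/

/-- The face of `T` opposite to vertex `m`. -/
def face (T : Tet) (m : Fin 4) : Set E3 := convexHull ℝ (T.points '' {m}ᶜ)

/-- A conforming tetrahedrization of the bounded open set `Ω`. -/
structure Tetrahedrization (Ω : Set E3) where
  /-- the number of tetrahedra -/
  card : ℕ
  /-- the tetrahedra -/
  tet : Fin card → Tet
  isOpen : IsOpen Ω
  closure_eq : closure Ω = ⋃ i, body (tet i)
  /-- different tetrahedra do not overlap -/
  disjoint_interior : ∀ i j, i ≠ j → Disjoint (interior (body (tet i))) (interior (body (tet j)))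
  /-- two tetrahedra meet in the (possibly empty) simplex spanned by their common vertices -/
  conforming : ∀ i j, body (tet i) ∩ body (tet j) =
    convexHull ℝ (Set.range (tet i).points ∩ Set.range (tet j).points)
  /-- the boundary of `Ω` is the union of the faces that belong to one tetrahedron only -/
  frontier_eq : frontier Ω =
    ⋃ i, ⋃ m, ⋃ (_ : ∀ j, j ≠ i → ¬ ((tet i).points '' {m}ᶜ ⊆ Set.range (tet j).points)),
      face (tet i) m

namespace Tetrahedrization

variable {Ω : Set E3} (M : Tetrahedrization Ω)

/-- Vertex `j` of tetrahedron `i`. -/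
def vertex (i : Fin M.card) (j : Fin 4) : E3 := (M.tet i).points j

/-- The edge between vertices `j` and `k` of tetrahedron `i`, for `j ≠ k`. -/
def edge (i : Fin M.card) (j k : Fin 4) : Set E3 := segment ℝ (M.vertex i j) (M.vertex i k)

/-- The midpoint of this edge. -/
def edgeMid (i : Fin M.card) (j k : Fin 4) : E3 := midpoint ℝ (M.vertex i j) (M.vertex i k)

/-- This edge is on the boundary of `Ω`; an edge that is not is an interior edge. -/
def OnBoundary (i : Fin M.card) (j k : Fin 4) : Prop := M.edge i j k ⊆ frontier Ω

/-- Every tetrahedron has at least three interior edges. -/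
def ThreeInteriorEdges : Prop :=
  ∀ i, 3 ≤ {e : Fin 4 × Fin 4 | e.1 < e.2 ∧ ¬ M.OnBoundary i e.1 e.2}.ncard

/-- The diameter `h_T` of tetrahedron `i`. -/
def diam (i : Fin M.card) : ℝ := Metric.diam (body (M.tet i))

/-- Shape regularity: each tetrahedron `T` contains a ball of radius `h_T / σ`. -/
def ShapeRegular (σ : ℝ) : Prop :=
  ∀ i, ∃ x, Metric.closedBall x (M.diam i / σ) ⊆ body (M.tet i)

/-! ### Finite element spaces

A piecewise polynomial function `v`, which may jump across the faces, is represented by the family of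
its restrictions to the tetrahedra: `v i` is the polynomial that coincides with `v` on tetrahedron
`i`. -/

/-- The scalar rotated `Q₁` space: shape functions on each tetrahedron, continuous at the midpoints
of the interior edges. -/
def Vh : Set (Fin M.card → E3 → ℝ) :=
  {v | (∀ i, v i ∈ shapeSpace (M.tet i)) ∧
    ∀ i i' j k j' k', j ≠ k → M.vertex i j = M.vertex i' j' → M.vertex i k = M.vertex i' k' →
      ¬ M.OnBoundary i j k → v i (M.edgeMid i j k) = v i' (M.edgeMid i j k)}

/-- The velocity space: three components in `Vh`, zero at the midpoints of the boundary edges. -/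
def Wh : Set (Fin M.card → E3 → E3) :=
  {v | (∀ l : Fin 3, (fun i x => v i x l) ∈ M.Vh) ∧
    ∀ i j k, j ≠ k → M.OnBoundary i j k → v i (M.edgeMid i j k) = 0}

/-- The pressure space: continuous, affine on each tetrahedron, of mean value zero. -/
def Qh : Set (E3 → ℝ) :=
  {q | ContinuousOn q (closure Ω) ∧ (∫ x in Ω, q x) = 0 ∧
    ∀ i, ∃ g : E3 →ᵃ[ℝ] ℝ, ∀ x ∈ body (M.tet i), q x = g x}

/-! ### Forms and norms -/

/-- The partial derivative `∂_l w` of a vector field. -/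
def partialDeriv (w : E3 → E3) (l : Fin 3) (x : E3) : E3 :=
  fderiv ℝ w x (EuclideanSpace.single l 1)

/-- The divergence of a vector field. -/
def divergence (w : E3 → E3) (x : E3) : ℝ := ∑ l, partialDeriv w l x l

/-- `a_h(v, w) = ∑_T (∇v, ∇w)_T`. -/
def ah (v w : Fin M.card → E3 → E3) : ℝ :=
  ∑ i, ∫ x in body (M.tet i), ∑ l, inner ℝ (partialDeriv (v i) l x) (partialDeriv (w i) l x)

/-- `‖v‖_{a_h} = a_h(v, v)^{1/2}`. -/
def ahNorm (v : Fin M.card → E3 → E3) : ℝ := Real.sqrt (M.ah v v)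

/-- `b(v, q) = ∑_T (∇ · v, q)_T - (n · v, q)_{∂T}`. -/
def b (v : Fin M.card → E3 → E3) (q : E3 → ℝ) : ℝ :=
  ∑ i, ((∫ x in body (M.tet i), divergence (v i) x * q x) - boundaryFlux (M.tet i) (v i) q)

end Tetrahedrization

/-- `‖∇q‖_Ω`, for `q` differentiable at almost every point of `Ω`. -/
def gradNorm (Ω : Set E3) (q : E3 → ℝ) : ℝ := Real.sqrt (∫ x in Ω, ‖gradient q x‖ ^ 2)

end RotatedQ1

end

/-!
The test velocity is explicit. Integrating by parts on each tetrahedron (`integral_divergence`,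
`boundaryFlux_eq`) turns `b(v, q)` into `-∑_T (v, ∇q)_T`, and since the six nodal shape functions
have equal integrals, `(v, ∇q)_T` is `|T| / 6` times the sum of `∇q · v(x_E)` over the edges `E` of
`T` (`local_form_eq`). Taking `v(x_E) = -(q(b) - q(a)) (b - a)` at the midpoint of each interior edge
`E = [a, b]` gives a well-defined element of `W_h`, because only the vertex values of `q` enter, and
`b(v, q) = S / 6`, where `S` is the sum of `|T| (q(b) - q(a))²` over all tetrahedra `T` and their
interior edges (`b_tangent`). Shape regularity bounds the gradients of the barycentric coordinates
by `σ / h_T`, so that `‖v‖²_{a_h}` is at most a multiple of `S` (`ah_tangent_le`).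

It remains to bound `h² ‖∇q‖²` by a multiple of `S`. On `T` the gradient of `q` is controlled by the
differences of `q` along all six edges of `T`, and three interior edges of `T` need not suffice, for
they may bound a common face. However, every boundary edge `[a, b]` lies in a boundary face of some
tetrahedron `T'`, and the three edges of `T'` issuing from the vertex `d` opposite to this face must
then be its three interior edges (`exists_interior_path`). So the difference of `q` along `[a, b]` is
controlled by those along the interior edges `[a, d]` and `[b, d]` of `T'`. The tetrahedra with an
edge in common with `T'` have size comparable to that of `T'` and do not overlap, so their total
volume is at most a multiple of `|T'|` (`sum_volume_shareEdge_le`), and summation over the mesh gives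
the bound (`sum_diffSum_le`, `gradNorm_le`).

If `S = 0` then `∇q = 0`, and it suffices to have some `v` in `W_h` of nonzero norm with
`b(v, q) ≥ 0`; a velocity living at one interior edge serves, up to its sign
(`exists_mem_Wh_b_nonneg`).
-/

open MeasureTheory

noncomputable section

namespace RotatedQ1

/-! ### Iterated integrals over the reference triangle and the reference tetrahedron -/

/-- Fubini's theorem on the region below the graph of `h` over the compact set `K`. -/
theorem setIntegral_region {X : Type*} [TopologicalSpace X] [T2Space X] [MeasurableSpace X]
    [BorelSpace X] [SecondCountableTopology X] (μ : Measure X) [SFinite μ]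
    [IsFiniteMeasureOnCompacts μ] {K : Set X} (hK : IsCompact K) {h : X → ℝ} (hc : Continuous h)
    (hn : ∀ x ∈ K, 0 ≤ h x) {g : X × ℝ → ℝ} (hg : Continuous g) :
    IsCompact {p : X × ℝ | p.1 ∈ K ∧ 0 ≤ p.2 ∧ p.2 ≤ h p.1} ∧
    ∫ p in {p : X × ℝ | p.1 ∈ K ∧ 0 ≤ p.2 ∧ p.2 ≤ h p.1}, g p ∂(μ.prod volume) =
      ∫ x in K, (∫ u in (0 : ℝ)..h x, g (x, u)) ∂μ := by
  have hS : IsCompact {p : X × ℝ | p.1 ∈ K ∧ 0 ≤ p.2 ∧ p.2 ≤ h p.1} := by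
    have : {p : X × ℝ | p.1 ∈ K ∧ 0 ≤ p.2 ∧ p.2 ≤ h p.1} =
        (fun p : X × ℝ => (p.1, p.2 * h p.1)) '' (K ×ˢ Set.Icc 0 1) := by
      ext ⟨x, u⟩
      simp only [Set.mem_ofPred_eq, Set.mem_image, Set.mem_prod, Set.mem_Icc, Prod.exists,
        Prod.mk.injEq]
      constructor
      · rintro ⟨hx, h0, h1⟩
        rcases (hn x hx).eq_or_lt with he | hl
        · exact ⟨x, 0, ⟨hx, le_rfl, zero_le_one⟩, rfl, by linarith⟩
        · exact ⟨x, u / h x, ⟨hx, by positivity, by rwa [div_le_one hl]⟩, rfl, by field_simp⟩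
      · rintro ⟨y, r, ⟨hy, h0, h1⟩, rfl, rfl⟩
        have := hn y hy
        exact ⟨hy, by positivity, by nlinarith⟩
    rw [this]
    exact (hK.prod isCompact_Icc).image (by fun_prop)
  refine ⟨hS, ?_⟩
  rw [← integral_indicator hS.measurableSet, integral_prod, ← integral_indicator hK.measurableSet]
  · congr 1
    ext x
    by_cases hx : x ∈ K
    · rw [Set.indicator_of_mem hx, intervalIntegral.integral_of_le (hn x hx),
        ← integral_Icc_eq_integral_Ioc, ← integral_indicator measurableSet_Icc]
      congr 1
      ext u
      simp only [Set.indicator, Set.mem_ofPred_eq, hx, true_and, Set.mem_Icc]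
    · simp [Set.indicator, hx]
  · rw [integrable_indicator_iff hS.measurableSet]
    exact hg.continuousOn.integrableOn_compact hS

/-- The reference triangle. -/
def stdTriangle : Set (ℝ × ℝ) := {p | p.1 ∈ Set.Icc 0 1 ∧ 0 ≤ p.2 ∧ p.2 ≤ 1 - p.1}

/-- The reference tetrahedron with one vertex at the origin and the others at the unit vectors. -/
def stdTet : Set ((ℝ × ℝ) × ℝ) :=
  {p | p.1 ∈ stdTriangle ∧ 0 ≤ p.2 ∧ p.2 ≤ 1 - p.1.1 - p.1.2}

theorem isCompact_stdTriangle : IsCompact stdTriangle :=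
  (setIntegral_region (volume : Measure ℝ) isCompact_Icc (h := fun s => 1 - s) (by fun_prop)
    (fun x hx => by linarith [hx.2]) (continuous_const (y := (0 : ℝ)))).1

theorem integral_stdTriangle {g : ℝ × ℝ → ℝ} (hg : Continuous g) :
    ∫ p in stdTriangle, g p = ∫ s in (0 : ℝ)..1, ∫ t in (0 : ℝ)..(1 - s), g (s, t) := by
  have := (setIntegral_region (volume : Measure ℝ) (isCompact_Icc (a := (0 : ℝ)) (b := 1))
    (h := fun s => 1 - s) (by fun_prop) (fun x hx => by linarith [hx.2]) hg).2
  rw [intervalIntegral.integral_of_le zero_le_one, ← integral_Icc_eq_integral_Ioc, ← this]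
  rfl

theorem isCompact_stdTet : IsCompact stdTet :=
  (setIntegral_region (volume : Measure (ℝ × ℝ)) isCompact_stdTriangle
    (h := fun p => 1 - p.1 - p.2) (by fun_prop)
    (fun x hx => by linarith [hx.2.2]) (continuous_const (y := (0 : ℝ)))).1

theorem integral_stdTet {g : (ℝ × ℝ) × ℝ → ℝ} (hg : Continuous g) :
    ∫ p in stdTet, g p =
      ∫ p in stdTriangle, ∫ u in (0 : ℝ)..(1 - p.1 - p.2), g (p, u) := by
  have := (setIntegral_region (volume : Measure (ℝ × ℝ)) isCompact_stdTriangle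
    (h := fun p => 1 - p.1 - p.2) (by fun_prop)
    (fun x hx => by linarith [hx.2.2]) hg).2
  rw [← this]
  rfl

theorem integral_stdTriangle_swap (g : ℝ × ℝ → ℝ) :
    ∫ p in stdTriangle, g p = ∫ p in stdTriangle, g p.swap := by
  have h := (Measure.measurePreserving_swap (μ := (volume : Measure ℝ))
    (ν := (volume : Measure ℝ))).setIntegral_preimage_emb
    MeasurableEquiv.prodComm.measurableEmbedding g stdTriangle
  have e : Prod.swap ⁻¹' stdTriangle = stdTriangle := by
    ext ⟨s, t⟩
    simp only [stdTriangle, Set.mem_preimage, Set.mem_ofPred_eq, Set.mem_Icc, Prod.swap_prod_mk]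
    constructor <;> rintro ⟨⟨_, _⟩, _, _⟩ <;> refine ⟨⟨?_, ?_⟩, ?_, ?_⟩ <;> linarith
  rw [e] at h
  exact h.symm

/-! ### Integrals over a triangle in space -/

/-- The integral of `f` over the triangle `a b c` in affine parameters, that is, its surface integral
divided by twice the area of the triangle. -/
def paramIntegral (a b c : E3) (f : E3 → ℝ) : ℝ :=
  ∫ s in (0 : ℝ)..1, ∫ t in (0 : ℝ)..(1 - s), f (a + s • (b - a) + t • (c - a))

theorem paramIntegral_eq (a b c : E3) {f : E3 → ℝ} (hf : Continuous f) :
    paramIntegral a b c f = ∫ p in stdTriangle, f (a + p.1 • (b - a) + p.2 • (c - a)) :=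
  (integral_stdTriangle (g := fun p => f (a + p.1 • (b - a) + p.2 • (c - a)))
    (by fun_prop)).symm

theorem paramIntegral_swap_right (a b c : E3) {f : E3 → ℝ} (hf : Continuous f) :
    paramIntegral a c b f = paramIntegral a b c f := by
  rw [paramIntegral_eq a b c hf, paramIntegral_eq a c b hf, integral_stdTriangle_swap]
  refine integral_congr_ae (Filter.Eventually.of_forall fun p => ?_)
  simp only [Prod.fst_swap, Prod.snd_swap]
  congr 1
  abel

theorem paramIntegral_swap_outer (a b c : E3) (f : E3 → ℝ) :
    paramIntegral c b a f = paramIntegral a b c f := by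
  unfold paramIntegral
  congr 1
  ext s
  have := intervalIntegral.integral_comp_sub_left (a := 0) (b := 1 - s)
    (fun t => f (a + s • (b - a) + t • (c - a))) (1 - s)
  simp only [sub_self, sub_zero] at this
  rw [← this]
  congr 1
  ext t
  congr 1
  module

theorem paramIntegral_swap_left (a b c : E3) {f : E3 → ℝ} (hf : Continuous f) :
    paramIntegral b a c f = paramIntegral a b c f := by
  rw [← paramIntegral_swap_right b a c hf, paramIntegral_swap_outer, paramIntegral_swap_right _ _ _ hf]

theorem paramIntegral_sub (a b c : E3) {f g : E3 → ℝ} (hf : Continuous f) (hg : Continuous g) :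
    paramIntegral a b c (fun x => f x - g x) = paramIntegral a b c f - paramIntegral a b c g := by
  rw [paramIntegral_eq _ _ _ hf, paramIntegral_eq _ _ _ hg,
    paramIntegral_eq _ _ _ (f := fun x => f x - g x) (hf.sub hg), integral_sub]
  · exact (Continuous.continuousOn (by fun_prop)).integrableOn_compact isCompact_stdTriangle
  · exact (Continuous.continuousOn (by fun_prop)).integrableOn_compact isCompact_stdTriangle

theorem paramIntegral_const_mul (a b c : E3) (r : ℝ) (f : E3 → ℝ) :
    paramIntegral a b c (fun x => r * f x) = r * paramIntegral a b c f := by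
  simp [paramIntegral]

theorem paramIntegral_congr {a b c : E3} {f g : E3 → ℝ}
    (h : ∀ x ∈ convexHull ℝ {a, b, c}, f x = g x) : paramIntegral a b c f = paramIntegral a b c g := by
  unfold paramIntegral
  refine intervalIntegral.integral_congr fun s hs => ?_
  rw [Set.uIcc_of_le zero_le_one] at hs
  refine intervalIntegral.integral_congr fun t ht => ?_
  rw [Set.uIcc_of_le (by linarith [hs.2])] at ht
  refine h _ ?_
  have := (convex_convexHull ℝ {a, b, c}).sum_mem (t := Finset.univ) (w := ![1 - s - t, s, t])
    (z := ![a, b, c])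
    (by
      intro i _
      fin_cases i
      · simpa using (by linarith [ht.2] : 0 ≤ 1 - s - t)
      · exact hs.1
      · exact ht.1)
    (by simp only [Fin.sum_univ_three, Matrix.cons_val]; ring) (by
      intro i _
      refine subset_convexHull ℝ _ ?_
      fin_cases i <;> simp)
  convert this using 1
  simp only [Fin.sum_univ_three, Matrix.cons_val]
  module

/-! ### Change of variables -/

/-- Space is identified with an iterated product, to which Fubini's theorem applies. -/
theorem measurePreserving_tripleEquiv :
    ∃ e : ((ℝ × ℝ) × ℝ) ≃ᵐ E3, MeasurePreserving e ∧
      ∀ p, e p = !₂[p.1.1, p.1.2, p.2] := by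
  let e₁ := MeasurableEquiv.piFinSuccAbove (fun _ : Fin 3 => ℝ) (Fin.last 2)
  have h₁ := volume_preserving_piFinSuccAbove (fun _ : Fin 3 => ℝ) (Fin.last 2)
  have h₂ := (MeasurePreserving.id (volume : Measure ℝ)).prod (volume_preserving_finTwoArrow ℝ)
  have h₃ := Measure.measurePreserving_swap (μ := (volume : Measure ℝ))
    (ν := (volume : Measure (ℝ × ℝ)))
  let e : E3 ≃ᵐ (ℝ × ℝ) × ℝ := ((MeasurableEquiv.toLp 2 (Fin 3 → ℝ)).symm.trans e₁).trans
    (((MeasurableEquiv.refl ℝ).prodCongr MeasurableEquiv.finTwoArrow).trans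
      MeasurableEquiv.prodComm)
  have he : MeasurePreserving e := (h₃.comp h₂).comp
    (h₁.comp (EuclideanSpace.volume_preserving_symm_measurableEquiv_toLp (Fin 3)))
  refine ⟨e.symm, he.symm e, fun p => ?_⟩
  rw [MeasurableEquiv.symm_apply_eq]
  rfl

/-- The scalar triple product, six times the signed volume of the tetrahedron spanned by `u, v, w`. -/
def tripleProduct (u v w : E3) : ℝ := inner ℝ (cross u v) w

theorem tripleProduct_eq (u v w : E3) : tripleProduct u v w =
    (u 1 * v 2 - u 2 * v 1) * w 0 + (u 2 * v 0 - u 0 * v 2) * w 1 +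
      (u 0 * v 1 - u 1 * v 0) * w 2 := by
  simp [tripleProduct, cross, crossProduct, PiLp.inner_apply, Fin.sum_univ_three]
  ring

/-- The linear map taking the unit vectors to `u, v, w`. -/
def frameMap (u v w : E3) : E3 →ₗ[ℝ] E3 :=
  Matrix.toLin (EuclideanSpace.basisFun (Fin 3) ℝ).toBasis (EuclideanSpace.basisFun (Fin 3) ℝ).toBasis
    (Matrix.of fun i j => (![u, v, w] j) i)

theorem det_frameMap (u v w : E3) : LinearMap.det (frameMap u v w) = tripleProduct u v w := by
  rw [frameMap, LinearMap.det_toLin, Matrix.det_fin_three, tripleProduct_eq]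
  simp
  ring

theorem frameMap_apply (u v w x : E3) : frameMap u v w x = x 0 • u + x 1 • v + x 2 • w := by
  ext i
  simp [frameMap, Matrix.toLin_apply, Matrix.mulVec, dotProduct, Fin.sum_univ_three]
  fin_cases i <;> simp <;> ring

theorem integral_image_stdTet (a u v w : E3) (hd : tripleProduct u v w ≠ 0) (f : E3 → ℝ) :
    ∫ x in (fun p : (ℝ × ℝ) × ℝ => a + p.1.1 • u + p.1.2 • v + p.2 • w) '' stdTet, f x =
      |tripleProduct u v w| *
        ∫ p in stdTet, f (a + p.1.1 • u + p.1.2 • v + p.2 • w) := by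
  obtain ⟨e, he, hep⟩ := measurePreserving_tripleEquiv
  let L := LinearMap.toContinuousLinearMap (frameMap u v w)
  have hdet : L.det = tripleProduct u v w := by
    rw [← det_frameMap]; rfl
  have hinj : Function.Injective L := by
    have := (LinearMap.equivOfDetNeZero (frameMap u v w)
      (by rw [det_frameMap]; exact hd)).injective
    exact this
  have himg : (fun p : (ℝ × ℝ) × ℝ => a + p.1.1 • u + p.1.2 • v + p.2 • w) '' stdTet =
      (fun x => a + L x) '' (e '' stdTet) := by
    rw [Set.image_image]
    refine Set.image_congr fun p _ => ?_
    rw [show L (e p) = frameMap u v w (e p) from rfl, frameMap_apply, hep]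
    simp [add_assoc]
  rw [himg, integral_image_eq_integral_abs_det_fderiv_smul volume
    (e.measurableSet_image.2 isCompact_stdTet.measurableSet)
    (fun x _ => ((L.hasFDerivAt (x := x)).const_add a).hasFDerivWithinAt)
    (fun x _ y _ hxy => hinj (add_left_cancel hxy)), hdet]
  simp only [smul_eq_mul]
  rw [integral_const_mul]
  congr 1
  rw [← he.setIntegral_preimage_emb e.measurableEmbedding, e.injective.preimage_image]
  refine integral_congr_ae (Filter.Eventually.of_forall fun p => ?_)
  simp only
  rw [show L (e p) = frameMap u v w (e p) from rfl, frameMap_apply, hep]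
  simp [add_assoc]

/-! ### Barycentric coordinates -/

/-- The vertices of a tetrahedron as an affine basis of space. -/
def baryBasis (T : Tet) : AffineBasis (Fin 4) ℝ E3 where
  toFun := T.points
  ind' := T.independent
  tot' := T.independent.affineSpan_eq_top_iff_card_eq_finrank_add_one.2 (by simp)

/-- The barycentric coordinate of `T` that is one at vertex `j`. -/
def bary (T : Tet) (j : Fin 4) : E3 →ᵃ[ℝ] ℝ := (baryBasis T).coord j

/-- The (constant) derivative of the barycentric coordinate `bary T j`. -/
def baryGrad (T : Tet) (j : Fin 4) : E3 →L[ℝ] ℝ := LinearMap.toContinuousLinearMap (bary T j).linear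

theorem bary_add (T : Tet) (j : Fin 4) (x w : E3) :
    bary T j (x + w) = bary T j x + baryGrad T j w := by
  have := (bary T j).map_vadd x w
  rw [vadd_eq_add, vadd_eq_add, add_comm w x] at this
  rw [this, add_comm]
  rfl

theorem baryGrad_sub (T : Tet) (j : Fin 4) (x y : E3) :
    baryGrad T j (x - y) = bary T j x - bary T j y := by
  have := bary_add T j y (x - y)
  rw [add_sub_cancel] at this
  rw [this]
  ring

theorem bary_vertex (T : Tet) (j k : Fin 4) : bary T j (T.points k) = if j = k then 1 else 0 :=
  (baryBasis T).coord_apply j k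

theorem sum_bary (T : Tet) (x : E3) : ∑ j, bary T j x = 1 :=
  (baryBasis T).sum_coord_apply_eq_one x

theorem sum_bary_smul (T : Tet) (x : E3) : ∑ j, bary T j x • T.points j = x :=
  (baryBasis T).linear_combination_coord_eq_self x

theorem mem_body {T : Tet} {x : E3} : x ∈ body T ↔ ∀ j, 0 ≤ bary T j x := by
  have := (baryBasis T).convexHull_eq_nonneg_coord
  exact Set.ext_iff.1 this x

theorem hasFDerivAt_bary (T : Tet) (j : Fin 4) (x : E3) :
    HasFDerivAt (bary T j) (baryGrad T j) x := by
  have h : (bary T j : E3 → ℝ) = fun y => baryGrad T j y + bary T j 0 := by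
    ext y
    have := bary_add T j 0 y
    rw [zero_add] at this
    rw [this, add_comm]
  rw [h]
  exact (baryGrad T j).hasFDerivAt.add_const _

theorem contDiff_bary (T : Tet) (j : Fin 4) {n : WithTop ℕ∞} : ContDiff ℝ n (bary T j) := by
  have h : (bary T j : E3 → ℝ) = fun y => baryGrad T j y + bary T j 0 := by
    ext y
    have := bary_add T j 0 y
    rw [zero_add] at this
    rw [this, add_comm]
  rw [h]
  fun_prop

@[fun_prop]
theorem continuous_bary (T : Tet) (j : Fin 4) : Continuous (bary T j) :=
  (contDiff_bary T j (n := 0)).continuous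

theorem bary_le_one {T : Tet} {x : E3} (hx : x ∈ body T) (j : Fin 4) : bary T j x ≤ 1 := by
  rw [← sum_bary T x]
  exact Finset.single_le_sum (fun i _ => mem_body.1 hx i) (Finset.mem_univ j)

theorem sum_baryGrad (T : Tet) (w : E3) : ∑ j, baryGrad T j w = 0 := by
  have h1 := sum_bary T (0 + w)
  simp only [bary_add, Finset.sum_add_distrib, sum_bary] at h1
  linarith

theorem baryGrad_edge (T : Tet) (m j k : Fin 4) : baryGrad T m (T.points j - T.points k) =
    (if m = j then 1 else 0) - (if m = k then 1 else 0) := by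
  rw [baryGrad_sub, bary_vertex, bary_vertex]

theorem sum_baryGrad_smul (T : Tet) (i : Fin 4) (w : E3) :
    ∑ j, baryGrad T j w • (T.points j - T.points i) = w := by
  have h1 := sum_bary_smul T (T.points i + w)
  have h2 := sum_bary_smul T (T.points i)
  simp only [bary_add, add_smul, Finset.sum_add_distrib, h2] at h1
  simp only [smul_sub, Finset.sum_sub_distrib, ← Finset.sum_smul, sum_baryGrad, zero_smul,
    sub_zero]
  exact add_left_cancel h1

theorem isCompact_body (T : Tet) : IsCompact (body T) :=
  (Set.finite_range T.points).isCompact_convexHull ℝ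

theorem convex_body (T : Tet) : Convex ℝ (body T) := convex_convexHull ℝ _

theorem vertex_mem_body (T : Tet) (j : Fin 4) : T.points j ∈ body T :=
  subset_convexHull ℝ _ ⟨j, rfl⟩

theorem interior_body_nonempty (T : Tet) : (interior (body T)).Nonempty :=
  (baryBasis T).interior_convexHull ▸ ⟨_, fun i => by
    have := (baryBasis T).centroid_mem_interior_convexHull
    rw [(baryBasis T).interior_convexHull] at this
    exact this i⟩

theorem volume_real_body_pos (T : Tet) : 0 < volume.real (body T) :=
  ENNReal.toReal_pos
    (Measure.measure_pos_of_nonempty_interior volume (interior_body_nonempty T)).ne'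
    (isCompact_body T).measure_lt_top.ne

theorem integrableOn_body_of_continuous {T : Tet} {f : E3 → ℝ} (hf : Continuous f) :
    IntegrableOn f (body T) := hf.continuousOn.integrableOn_compact (isCompact_body T)

/-! ### Integration over a tetrahedron in affine coordinates -/

theorem distinct_of_univ : ∀ {i j k l : Fin 4}, ({i, j, k, l} : Finset (Fin 4)) = Finset.univ →
    i ≠ j ∧ i ≠ k ∧ i ≠ l ∧ j ≠ k ∧ j ≠ l ∧ k ≠ l := by
  decide

theorem sum_eq_of_univ {i j k l : Fin 4} (h : ({i, j, k, l} : Finset (Fin 4)) = Finset.univ)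
    {A : Type*} [AddCommMonoid A] (f : Fin 4 → A) : ∑ m, f m = f i + f j + f k + f l := by
  obtain ⟨h1, h2, h3, h4, h5, h6⟩ := distinct_of_univ h
  rw [← h, Finset.sum_insert (by simp [*]), Finset.sum_insert (by simp [*]),
    Finset.sum_insert (by simp [*]), Finset.sum_singleton]
  simp only [add_assoc]

/-- Affine coordinates on `T` with origin at vertex `i` and axes along the edges to the vertices
`j, k, l`. -/
def chart (T : Tet) (i j k l : Fin 4) (p : (ℝ × ℝ) × ℝ) : E3 :=
  T.points i + p.1.1 • (T.points j - T.points i) + p.1.2 • (T.points k - T.points i) +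
    p.2 • (T.points l - T.points i)

@[fun_prop]
theorem continuous_chart (T : Tet) (i j k l : Fin 4) : Continuous (chart T i j k l) := by
  unfold chart
  fun_prop

theorem bary_chart (T : Tet) {i j k l : Fin 4}
    (h : ({i, j, k, l} : Finset (Fin 4)) = Finset.univ) (p : (ℝ × ℝ) × ℝ) :
    bary T i (chart T i j k l p) = 1 - p.1.1 - p.1.2 - p.2 ∧
    bary T j (chart T i j k l p) = p.1.1 ∧ bary T k (chart T i j k l p) = p.1.2 ∧
    bary T l (chart T i j k l p) = p.2 := by
  obtain ⟨h1, h2, h3, h4, h5, h6⟩ := distinct_of_univ h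
  simp [chart, bary_add, map_smul, baryGrad_edge, bary_vertex, h1, h2, h3, h4, h5, h6, h1.symm,
    h2.symm, h3.symm, h4.symm, h5.symm, h6.symm]
  ring

theorem image_chart (T : Tet) {i j k l : Fin 4}
    (h : ({i, j, k, l} : Finset (Fin 4)) = Finset.univ) :
    chart T i j k l '' stdTet = body T := by
  ext x
  constructor
  · rintro ⟨p, ⟨⟨⟨h1, h2⟩, h3, h4⟩, h5, h6⟩, rfl⟩
    rw [mem_body]
    intro m
    obtain ⟨e1, e2, e3, e4⟩ := bary_chart T h p
    have hm : m ∈ ({i, j, k, l} : Finset (Fin 4)) := h ▸ Finset.mem_univ m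
    simp only [Finset.mem_insert, Finset.mem_singleton] at hm
    rcases hm with rfl | rfl | rfl | rfl <;> linarith
  · intro hx
    have hx' := mem_body.1 hx
    have hs := sum_bary T x
    have hp := sum_bary_smul T x
    rw [sum_eq_of_univ h] at hs hp
    refine ⟨((bary T j x, bary T k x), bary T l x), ?_, ?_⟩
    · have := hx' i; have := hx' j; have := hx' k; have := hx' l
      refine ⟨⟨⟨?_, ?_⟩, ?_, ?_⟩, ?_, ?_⟩ <;> simp only <;> linarith
    · have e : bary T i x = 1 - bary T j x - bary T k x - bary T l x := by linarith
      rw [e] at hp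
      conv_rhs => rw [← hp]
      simp only [chart]
      module

theorem tripleProduct_edges_ne_zero (T : Tet) {i j k l : Fin 4}
    (h : ({i, j, k, l} : Finset (Fin 4)) = Finset.univ) :
    tripleProduct (T.points j - T.points i) (T.points k - T.points i)
      (T.points l - T.points i) ≠ 0 := by
  intro h0
  rw [← det_frameMap] at h0
  have := LinearMap.bot_lt_ker_of_det_eq_zero h0
  obtain ⟨x, hx, hx0⟩ := (Submodule.ne_bot_iff _).1 this.ne'
  rw [LinearMap.mem_ker, frameMap_apply] at hx
  apply hx0
  obtain ⟨h1, h2, h3, h4, h5, h6⟩ := distinct_of_univ h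
  have hj := congrArg (baryGrad T j) hx
  have hk := congrArg (baryGrad T k) hx
  have hl := congrArg (baryGrad T l) hx
  simp [baryGrad_edge, h4, h5, h6, h1.symm, h2.symm, h3.symm, h4.symm, h5.symm, h6.symm] at hj hk hl
  ext m
  fin_cases m <;> simpa

/-- The Jacobian determinant of the affine coordinates, six times the volume of `T`. -/
def jac (T : Tet) : ℝ := |tripleProduct (T.points 1 - T.points 0) (T.points 2 - T.points 0)
  (T.points 3 - T.points 0)|

/-- The Jacobian does not depend on the order of the vertices, since it is proportional to the
volume. -/
theorem abs_tripleProduct_edges (T : Tet) {i j k l : Fin 4}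
    (h : ({i, j, k, l} : Finset (Fin 4)) = Finset.univ) :
    |tripleProduct (T.points j - T.points i) (T.points k - T.points i)
      (T.points l - T.points i)| = jac T := by
  have key : ∀ {i j k l : Fin 4}, ({i, j, k, l} : Finset (Fin 4)) = Finset.univ →
      volume.real (body T) = |tripleProduct (T.points j - T.points i) (T.points k - T.points i)
      (T.points l - T.points i)| * volume.real stdTet := by
    intro i j k l h
    have := integral_image_stdTet (T.points i) _ _ _ (tripleProduct_edges_ne_zero T h)
      (fun _ => (1 : ℝ))
    simp only [setIntegral_const, smul_eq_mul, mul_one] at this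
    rw [← this, ← image_chart T h]
    rfl
  have h0 := key (i := 0) (j := 1) (k := 2) (l := 3) (by decide)
  have h1 := key h
  have hpos := volume_real_body_pos T
  have hne : volume.real stdTet ≠ 0 := by
    intro hz
    rw [hz, mul_zero] at h0
    exact hpos.ne' h0
  exact mul_right_cancel₀ hne (h1.symm.trans h0)

theorem integral_body (T : Tet) {i j k l : Fin 4}
    (h : ({i, j, k, l} : Finset (Fin 4)) = Finset.univ) (f : E3 → ℝ) :
    ∫ x in body T, f x = jac T * ∫ p in stdTet, f (chart T i j k l p) := by
  rw [← abs_tripleProduct_edges T h, ← image_chart T h]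
  exact integral_image_stdTet _ _ _ _ (tripleProduct_edges_ne_zero T h) f

/-! ### The divergence theorem on a tetrahedron -/

/-- The divergence theorem for the direction of the edge from vertex `i` to vertex `l`. -/
theorem integral_fderiv_edge (T : Tet) {i j k l : Fin 4}
    (h : ({i, j, k, l} : Finset (Fin 4)) = Finset.univ) {f : E3 → ℝ} (hf : ContDiff ℝ 1 f) :
    ∫ x in body T, fderiv ℝ f x (T.points l - T.points i) =
      jac T * (paramIntegral (T.points l) (T.points j) (T.points k) f -
        paramIntegral (T.points i) (T.points j) (T.points k) f) := by
  have hd : Continuous (fderiv ℝ f) := hf.continuous_fderiv one_ne_zero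
  have hfc := hf.continuous
  rw [integral_body T h, integral_stdTet (by fun_prop), paramIntegral_eq _ _ _ hfc,
    paramIntegral_eq _ _ _ hfc, ← integral_sub]
  rotate_left
  · exact (Continuous.continuousOn (by fun_prop)).integrableOn_compact isCompact_stdTriangle
  · exact (Continuous.continuousOn (by fun_prop)).integrableOn_compact isCompact_stdTriangle
  congr 1
  refine integral_congr_ae (Filter.Eventually.of_forall fun p => ?_)
  simp only
  have hder : ∀ u : ℝ, HasDerivAt (fun u => f (chart T i j k l (p, u)))
      (fderiv ℝ f (chart T i j k l (p, u)) (T.points l - T.points i)) u := by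
    intro u
    refine (hf.differentiable one_ne_zero _).hasFDerivAt.comp_hasDerivAt u ?_
    have := ((hasDerivAt_id u).smul_const (T.points l - T.points i)).const_add
      (T.points i + p.1 • (T.points j - T.points i) + p.2 • (T.points k - T.points i))
    simpa [chart] using this
  rw [intervalIntegral.integral_eq_sub_of_hasDerivAt (fun u _ => hder u)
    (Continuous.intervalIntegrable (by fun_prop) _ _)]
  congr 2
  · simp only [chart]
    module
  · simp [chart]

/-- The trace in the basis of edges issuing from vertex `0`; the summand `i = 0` vanishes. -/
theorem trace_eq_sum_baryGrad (T : Tet) (L : E3 →L[ℝ] E3) :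
    ∑ l, L (EuclideanSpace.single l 1) l =
      ∑ i, baryGrad T i (L (T.points i - T.points 0)) := by
  have h1 : ∀ l, L (EuclideanSpace.single l 1) l =
      ∑ i, baryGrad T i (EuclideanSpace.single l 1) * L (T.points i - T.points 0) l := by
    intro l
    conv_lhs => rw [← sum_baryGrad_smul T 0 (EuclideanSpace.single l 1)]
    simp
  simp only [h1]
  rw [Finset.sum_comm]
  refine Finset.sum_congr rfl fun i _ => ?_
  have h2 : ∀ w : E3, baryGrad T i w = ∑ l, baryGrad T i (EuclideanSpace.single l 1) * w l := by
    intro w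
    have : w = ∑ l, w l • EuclideanSpace.single l (1 : ℝ) := by
      ext m
      simp [Finset.sum_apply, Pi.single_apply]
    conv_lhs => rw [this]
    simp [mul_comm]
  rw [h2 (L _)]

/-- The divergence theorem on a tetrahedron. The divergence is expanded in the edges issuing from
vertex `0` and their dual basis of barycentric gradients; up to a scalar, the normals are
these gradients. -/
theorem integral_divergence (T : Tet) {F : E3 → E3} (hF : ContDiff ℝ 1 F) :
    ∫ x in body T, Tetrahedrization.divergence F x =
      -jac T * ∑ m, paramIntegral (faceVertex T m 0) (faceVertex T m 1) (faceVertex T m 2)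
        (fun x => baryGrad T m (F x)) := by
  have hd : Continuous (fderiv ℝ F) := hF.continuous_fderiv one_ne_zero
  have hFc := hF.continuous
  have h1 : ∀ x, Tetrahedrization.divergence F x =
      ∑ i, fderiv ℝ (fun y => baryGrad T i (F y)) x (T.points i - T.points 0) := by
    intro x
    refine (trace_eq_sum_baryGrad T (fderiv ℝ F x)).trans (Finset.sum_congr rfl fun i _ => ?_)
    have := ((baryGrad T i).hasFDerivAt (x := F x)).comp x
      (hF.differentiable one_ne_zero x).hasFDerivAt
    rw [show (fun y => baryGrad T i (F y)) = baryGrad T i ∘ F from rfl, this.fderiv]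
    rfl
  have hf : ∀ i, ContDiff ℝ 1 (fun y => baryGrad T i (F y)) := fun i =>
    (baryGrad T i).contDiff.comp hF
  have hz : ∀ x, baryGrad T 0 (F x) =
      0 - baryGrad T 1 (F x) - baryGrad T 2 (F x) - baryGrad T 3 (F x) := by
    intro x
    have := sum_baryGrad T (F x)
    rw [Fin.sum_univ_four] at this
    linarith
  simp only [h1]
  rw [integral_finsetSum]
  swap
  · intro i _
    have hd := (hf i).continuous_fderiv one_ne_zero
    exact integrableOn_body_of_continuous (by fun_prop)
  simp only [Fin.sum_univ_four, sub_self, map_zero, integral_zero, zero_add]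
  rw [integral_fderiv_edge T (i := 0) (j := 2) (k := 3) (l := 1) (by decide) (hf 1),
    integral_fderiv_edge T (i := 0) (j := 1) (k := 3) (l := 2) (by decide) (hf 2),
    integral_fderiv_edge T (i := 0) (j := 1) (k := 2) (l := 3) (by decide) (hf 3)]
  simp only [hz, faceVertex]
  rw [paramIntegral_sub _ _ _ (by fun_prop) (by fun_prop),
    paramIntegral_sub _ _ _ (by fun_prop) (by fun_prop),
    paramIntegral_sub _ _ _ (by fun_prop) (by fun_prop),
    paramIntegral_swap_left (T.points 1) (T.points 2) (T.points 3) (by fun_prop),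
    paramIntegral_swap_left (T.points 1) (T.points 3) (T.points 2) (by fun_prop),
    paramIntegral_swap_right (T.points 1) (T.points 2) (T.points 3) (by fun_prop)]
  have z : ∀ a b c : E3, paramIntegral a b c (fun _ => 0) = 0 := by simp [paramIntegral]
  simp only [z]
  simp [Fin.succAbove]
  ring

/-- The outward normal scaled by twice the area of the face is a multiple of the gradient of the
barycentric coordinate that vanishes on the face. -/
theorem norm_faceNormal_mul_outwardNormal (T : Tet) (m : Fin 4) (w : E3) :
    ‖faceNormal T m‖ * inner ℝ (outwardNormal T m) w = -jac T * baryGrad T m w := by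
  have hu : ({m.succAbove 0, m.succAbove 1, m.succAbove 2, m} : Finset (Fin 4)) = Finset.univ := by
    revert m; decide
  have hj := abs_tripleProduct_edges T hu
  have hne := tripleProduct_edges_ne_zero T hu
  set N := faceNormal T m with hN
  set D : ℝ := inner ℝ N (faceVertex T m 0 - T.points m) with hD
  have hD' : D = -tripleProduct (T.points (m.succAbove 1) - T.points (m.succAbove 0))
      (T.points (m.succAbove 2) - T.points (m.succAbove 0))
      (T.points m - T.points (m.succAbove 0)) := by
    rw [hD, ← neg_sub, inner_neg_right]
    rfl
  have hD0 : D ≠ 0 := by rw [hD']; exact neg_ne_zero.2 hne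
  have hN0 : ‖N‖ ≠ 0 := by
    intro h
    rw [norm_eq_zero] at h
    exact hD0 (by rw [hD, h, inner_zero_left])
  have hw : inner ℝ N w = -baryGrad T m w * D := by
    have e1 : ∀ u v : E3, tripleProduct u v u = 0 := fun u v => by rw [tripleProduct_eq]; ring
    have e2 : ∀ u v : E3, tripleProduct u v v = 0 := fun u v => by rw [tripleProduct_eq]; ring
    have hs := sum_baryGrad_smul T (m.succAbove 0) w
    rw [sum_eq_of_univ hu] at hs
    conv_lhs => rw [← hs]
    rw [inner_add_right, inner_add_right, inner_add_right, real_inner_smul_right,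
      real_inner_smul_right, real_inner_smul_right, real_inner_smul_right, sub_self,
      inner_zero_right, mul_zero, hD']
    have i1 : inner ℝ N (T.points (m.succAbove 1) - T.points (m.succAbove 0)) = 0 := e1 _ _
    have i2 : inner ℝ N (T.points (m.succAbove 2) - T.points (m.succAbove 0)) = 0 := e2 _ _
    rw [i1, i2]
    simp only [tripleProduct, hN, faceNormal, faceVertex]
    ring
  rw [outwardNormal, ← hN, ← hD, real_inner_smul_left, real_inner_smul_left, hw]
  have hs : (SignType.sign D : ℝ) * D = jac T := by
    rw [sign_mul_self, hD', abs_neg, hj]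
  rw [← hs]
  field_simp

theorem boundaryFlux_eq (T : Tet) (w : E3 → E3) (q : E3 → ℝ) :
    boundaryFlux T w q = -jac T * ∑ m, paramIntegral (faceVertex T m 0) (faceVertex T m 1)
      (faceVertex T m 2) (fun x => baryGrad T m (q x • w x)) := by
  rw [boundaryFlux, Finset.mul_sum]
  refine Finset.sum_congr rfl fun m _ => ?_
  rw [← paramIntegral_const_mul]
  simp only [map_smul, smul_eq_mul]
  have : ∀ x, -jac T * (q x * baryGrad T m (w x)) =
      ‖faceNormal T m‖ * (inner ℝ (outwardNormal T m) (w x) * q x) := by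
    intro x
    rw [← mul_assoc ‖_‖, norm_faceNormal_mul_outwardNormal]
    ring
  simp only [this]
  rw [paramIntegral_const_mul]
  rfl

/-! ### Shape functions -/

/-- The shape function of the edge from vertex `j` to vertex `k`: it is one at the midpoint of this
edge and zero at the midpoints of the other five. In the coordinates of the reference element, where
the midpoint is `±eᵢ`, it is `1 / 6 ± xᵢ / 2 + (3 xᵢ² - |x|²) / 6`. -/
def shapeFun (T : Tet) (j k : Fin 4) (x : E3) : ℝ :=
  1 / 3 + 2 * (bary T j x + bary T k x) ^ 2 - (bary T j x + bary T k x) -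
    2 / 3 * ∑ m, bary T m x ^ 2

theorem contDiff_shapeFun (T : Tet) (j k : Fin 4) {n : WithTop ℕ∞} :
    ContDiff ℝ n (shapeFun T j k) := by
  have := fun m => contDiff_bary T m (n := n)
  unfold shapeFun
  fun_prop

@[fun_prop]
theorem continuous_shapeFun (T : Tet) (j k : Fin 4) : Continuous (shapeFun T j k) :=
  (contDiff_shapeFun T j k (n := 0)).continuous

theorem bary_midpoint (T : Tet) (m j k : Fin 4) :
    bary T m (midpoint ℝ (T.points j) (T.points k)) =
      ((if m = j then 1 else 0) + (if m = k then 1 else 0)) / 2 := by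
  rw [AffineMap.map_midpoint, bary_vertex, bary_vertex, midpoint_eq_smul_add]
  simp
  ring

theorem shapeFun_midpoint (T : Tet) {j k j' k' : Fin 4} (h : j < k) (h' : j' < k') :
    shapeFun T j k (midpoint ℝ (T.points j') (T.points k')) =
      if (j, k) = (j', k') then 1 else 0 := by
  simp only [shapeFun, bary_midpoint, Fin.sum_univ_four]
  fin_cases j <;> fin_cases k <;> first | exact absurd h (by decide) |
    fin_cases j' <;> fin_cases k' <;> first | exact absurd h' (by decide) | (simp; try norm_num)

theorem bary_refMap (T : Tet) (j : Fin 4) (x : E3) :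
    bary T j (refMap T x) = (1 + inner ℝ (refVertex j) x) / 4 := by
  have hs : ∑ k, (1 + inner ℝ (refVertex k) x) / 4 = 1 := by
    simp [Fin.sum_univ_four, refVertex, PiLp.inner_apply, Fin.sum_univ_three]
    ring
  have e : refMap T x = T.points 0 +
      ∑ k, ((1 + inner ℝ (refVertex k) x) / 4) • (T.points k - T.points 0) := by
    simp only [refMap, smul_sub, Finset.sum_sub_distrib, ← Finset.sum_smul, hs, one_smul]
    abel
  rw [e, bary_add, map_sum, bary_vertex]
  simp only [map_smul, baryGrad_edge, smul_eq_mul, mul_sub, Finset.sum_sub_distrib,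
    ← Finset.sum_mul, hs]
  simp

theorem mem_refSpace (c a₀ a₁ a₂ b₁ b₂ : ℝ) :
    (fun x : E3 => c + a₀ * x 0 + a₁ * x 1 + a₂ * x 2 + b₁ * (x 0 ^ 2 - x 1 ^ 2) +
      b₂ * (x 1 ^ 2 - x 2 ^ 2)) ∈ refSpace := by
  have hg : ∀ f : E3 → ℝ, f ∈ ({fun _ => 1, fun x => x 0, fun x => x 1, fun x => x 2,
      fun x => x 0 ^ 2 - x 1 ^ 2, fun x => x 1 ^ 2 - x 2 ^ 2} : Set (E3 → ℝ)) → f ∈ refSpace :=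
    fun f hf => Submodule.subset_span hf
  have h := refSpace.add_mem (refSpace.add_mem (refSpace.add_mem (refSpace.add_mem
    (refSpace.add_mem (refSpace.smul_mem c (hg (fun _ => 1) (by simp)))
    (refSpace.smul_mem a₀ (hg (fun x => x 0) (by simp))))
    (refSpace.smul_mem a₁ (hg (fun x => x 1) (by simp))))
    (refSpace.smul_mem a₂ (hg (fun x => x 2) (by simp))))
    (refSpace.smul_mem b₁ (hg (fun x => x 0 ^ 2 - x 1 ^ 2) (by simp))))
    (refSpace.smul_mem b₂ (hg (fun x => x 1 ^ 2 - x 2 ^ 2) (by simp)))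
  convert h using 1
  ext x
  simp

theorem shapeFun_comp_refMap_mem (T : Tet) {j k : Fin 4} (h : j < k) :
    shapeFun T j k ∘ refMap T ∈ refSpace := by
  have key : ∃ c a₀ a₁ a₂ b₁ b₂ : ℝ, ∀ x : E3, shapeFun T j k (refMap T x) =
      c + a₀ * x 0 + a₁ * x 1 + a₂ * x 2 + b₁ * (x 0 ^ 2 - x 1 ^ 2) +
      b₂ * (x 1 ^ 2 - x 2 ^ 2) := by
    simp only [shapeFun, bary_refMap, Fin.sum_univ_four]
    fin_cases j <;> fin_cases k <;> first | exact absurd h (by decide) | skip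
    -- The six edge midpoints are `e₁, e₂, e₃, -e₃, -e₂, -e₁`, in this order.
    · refine ⟨1 / 6, 1 / 2, 0, 0, 1 / 3, 1 / 6, fun x => ?_⟩
      simp [refVertex, PiLp.inner_apply, Fin.sum_univ_three]
      ring
    · refine ⟨1 / 6, 0, 1 / 2, 0, -1 / 6, 1 / 6, fun x => ?_⟩
      simp [refVertex, PiLp.inner_apply, Fin.sum_univ_three]
      ring
    · refine ⟨1 / 6, 0, 0, 1 / 2, -1 / 6, -1 / 3, fun x => ?_⟩
      simp [refVertex, PiLp.inner_apply, Fin.sum_univ_three]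
      ring
    · refine ⟨1 / 6, 0, 0, -1 / 2, -1 / 6, -1 / 3, fun x => ?_⟩
      simp [refVertex, PiLp.inner_apply, Fin.sum_univ_three]
      ring
    · refine ⟨1 / 6, 0, -1 / 2, 0, -1 / 6, 1 / 6, fun x => ?_⟩
      simp [refVertex, PiLp.inner_apply, Fin.sum_univ_three]
      ring
    · refine ⟨1 / 6, -1 / 2, 0, 0, 1 / 3, 1 / 6, fun x => ?_⟩
      simp [refVertex, PiLp.inner_apply, Fin.sum_univ_three]
      ring
  obtain ⟨c, a₀, a₁, a₂, b₁, b₂, hx⟩ := key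
  convert mem_refSpace c a₀ a₁ a₂ b₁ b₂ using 1
  ext x
  exact hx x

/-- The six edges of a tetrahedron, as increasing pairs of vertices. -/
def edges : Finset (Fin 4 × Fin 4) := Finset.univ.filter fun e => e.1 < e.2

theorem edges_eq : edges = {(0, 1), (0, 2), (0, 3), (1, 2), (1, 3), (2, 3)} := by decide

theorem mem_edges {e : Fin 4 × Fin 4} : e ∈ edges ↔ e.1 < e.2 := by simp [edges]

theorem sum_edges {A : Type*} [AddCommMonoid A] (f : Fin 4 × Fin 4 → A) : ∑ e ∈ edges, f e =
    f (0, 1) + f (0, 2) + f (0, 3) + f (1, 2) + f (1, 3) + f (2, 3) := by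
  rw [edges_eq]
  repeat rw [Finset.sum_insert (by decide)]
  rw [Finset.sum_singleton]
  simp only [add_assoc]

theorem sum_shapeFun (T : Tet) (x : E3) : ∑ e ∈ edges, shapeFun T e.1 e.2 x = 1 := by
  have h := sum_bary T x
  rw [Fin.sum_univ_four] at h
  have h3 : bary T 3 x = 1 - bary T 0 x - bary T 1 x - bary T 2 x := by linarith
  simp only [sum_edges, shapeFun, Fin.sum_univ_four, h3]
  ring

/-- By symmetry the six shape functions have the same integral, and their sum is one. -/
theorem integral_shapeFun (T : Tet) {j k : Fin 4} (h : j < k) :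
    ∫ x in body T, shapeFun T j k x = volume.real (body T) / 6 := by
  let Φ : ℝ → ℝ → ℝ → ℝ → ℝ := fun a b c d =>
    1 / 3 + 2 * (a + b) ^ 2 - (a + b) - 2 / 3 * (a ^ 2 + b ^ 2 + c ^ 2 + d ^ 2)
  have key : ∀ {i j k l : Fin 4}, ({i, j, k, l} : Finset (Fin 4)) = Finset.univ →
      ∫ x in body T, shapeFun T i j x =
        jac T * ∫ p in stdTet, Φ (1 - p.1.1 - p.1.2 - p.2) p.1.1 p.1.2 p.2 := by
    intro i j k l h
    rw [integral_body T h]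
    congr 1
    refine integral_congr_ae (Filter.Eventually.of_forall fun p => ?_)
    obtain ⟨e1, e2, e3, e4⟩ := bary_chart T h p
    simp only [shapeFun, sum_eq_of_univ h, e1, e2, e3, e4, Φ]
  have hall : ∀ j k : Fin 4, j < k → ∃ l m : Fin 4,
      ({j, k, l, m} : Finset (Fin 4)) = Finset.univ := by decide
  have hc : ∀ j k : Fin 4, j < k → ∫ x in body T, shapeFun T j k x =
        jac T * ∫ p in stdTet, Φ (1 - p.1.1 - p.1.2 - p.2) p.1.1 p.1.2 p.2 := by
    intro j k hjk
    obtain ⟨l, m, hu⟩ := hall j k hjk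
    exact key hu
  have hsum : ∫ x in body T, ∑ e ∈ edges, shapeFun T e.1 e.2 x = volume.real (body T) := by
    simp [sum_shapeFun]
  rw [integral_finsetSum _ fun e _ => integrableOn_body_of_continuous (by fun_prop),
    Finset.sum_congr rfl fun e he => hc e.1 e.2 (mem_edges.1 he)] at hsum
  rw [hc j k h, ← hsum, Finset.sum_const, show edges.card = 6 by decide]
  simp

/-- A barycentric coordinate takes values in `[0, 1]` on the ball, so its slope is at most `1 / R`. -/
theorem norm_baryGrad_le {T : Tet} {c : E3} {R : ℝ} (hR : 0 < R)
    (hb : Metric.closedBall c R ⊆ body T) (j : Fin 4) : ‖baryGrad T j‖ ≤ 1 / R := by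
  refine ContinuousLinearMap.opNorm_le_bound _ (by positivity) fun w => ?_
  rcases eq_or_ne w 0 with rfl | hw
  · simp
  have hw' : 0 < ‖w‖ := norm_pos_iff.2 hw
  have hmem : c + (R / ‖w‖) • w ∈ body T := hb (by
    rw [mem_closedBall_iff_norm, add_sub_cancel_left, norm_smul, Real.norm_eq_abs,
      abs_of_pos (by positivity)]
    field_simp; exact le_rfl)
  have hc : c ∈ body T := hb (Metric.mem_closedBall_self hR.le)
  have h1 := mem_body.1 hmem j
  have h2 := bary_le_one hmem j
  have h3 := mem_body.1 hc j
  have h4 := bary_le_one hc j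
  rw [bary_add, map_smul, smul_eq_mul] at h1 h2
  have h5 : |R / ‖w‖ * baryGrad T j w| ≤ 1 := abs_le.2 ⟨by linarith, by linarith⟩
  rw [abs_mul, abs_of_pos (by positivity)] at h5
  rw [Real.norm_eq_abs]
  calc |baryGrad T j w| = (‖w‖ / R) * (R / ‖w‖ * |baryGrad T j w|) := by field_simp
    _ ≤ (‖w‖ / R) * 1 := by gcongr
    _ = 1 / R * ‖w‖ := by ring

/-- The derivative of `shapeFun T j k` at `x`. -/
def shapeGrad (T : Tet) (j k : Fin 4) (x : E3) : E3 →L[ℝ] ℝ :=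
  (4 * (bary T j x + bary T k x) - 1) • (baryGrad T j + baryGrad T k) -
    (4 / 3 : ℝ) • ∑ m, bary T m x • baryGrad T m

theorem hasFDerivAt_shapeFun (T : Tet) (j k : Fin 4) (x : E3) :
    HasFDerivAt (shapeFun T j k) (shapeGrad T j k x) x := by
  have hμ := (hasFDerivAt_bary T j x).add (hasFDerivAt_bary T k x)
  have hs := HasFDerivAt.fun_sum (u := Finset.univ)
    (fun m (_ : m ∈ Finset.univ) => (hasFDerivAt_bary T m x).pow 2)
  have := (((hμ.pow 2).const_mul 2).const_add (1 / 3) |>.sub hμ).sub (hs.const_mul (2 / 3))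
  refine this.congr_fderiv ?_
  ext w
  simp [shapeGrad, Fin.sum_univ_four]
  ring

theorem norm_shapeGrad_le {T : Tet} {c : E3} {R : ℝ} (hR : 0 < R)
    (hb : Metric.closedBall c R ⊆ body T) (j k : Fin 4) {x : E3} (hx : x ∈ body T) :
    ‖shapeGrad T j k x‖ ≤ 16 / R := by
  have hg := norm_baryGrad_le hR hb
  have h0 := mem_body.1 hx
  have h1 := bary_le_one hx
  have n1 : ‖(4 * (bary T j x + bary T k x) - 1) • (baryGrad T j + baryGrad T k)‖ ≤
      7 * (1 / R + 1 / R) := by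
    rw [norm_smul]
    refine mul_le_mul ?_ ((norm_add_le _ _).trans (add_le_add (hg j) (hg k))) (norm_nonneg _)
      (by norm_num)
    rw [Real.norm_eq_abs, abs_le]
    constructor <;> linarith [h0 j, h0 k, h1 j, h1 k]
  have n2 : ‖∑ m, bary T m x • baryGrad T m‖ ≤ 1 / R := by
    calc ‖∑ m, bary T m x • baryGrad T m‖ ≤ ∑ m, bary T m x * (1 / R) := by
          refine norm_sum_le_of_le _ fun m _ => ?_
          rw [norm_smul, Real.norm_eq_abs, abs_of_nonneg (h0 m)]
          exact mul_le_mul_of_nonneg_left (hg m) (h0 m)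
      _ = 1 / R := by rw [← Finset.sum_mul, sum_bary, one_mul]
  refine (norm_sub_le _ _).trans ?_
  rw [norm_smul (4 / 3 : ℝ)]
  have : ‖(4 / 3 : ℝ)‖ = 4 / 3 := by norm_num
  rw [this]
  have hR' : 0 < 1 / R := by positivity
  rw [show 16 / R = 16 * (1 / R) by ring]
  linarith

/-! ### Fields with prescribed values at the edge midpoints -/

/-- The field on `T` with components in the shape space and value `y j k` at the midpoint of the
edge `j k`, `j < k`. -/
def localField (T : Tet) (y : Fin 4 → Fin 4 → E3) (x : E3) : E3 :=
  ∑ e ∈ edges, shapeFun T e.1 e.2 x • y e.1 e.2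

theorem contDiff_localField (T : Tet) (y : Fin 4 → Fin 4 → E3) {n : WithTop ℕ∞} :
    ContDiff ℝ n (localField T y) :=
  ContDiff.sum fun e _ => (contDiff_shapeFun T e.1 e.2).smul contDiff_const

theorem localField_mem_shapeSpace (T : Tet) (y : Fin 4 → Fin 4 → E3) (l : Fin 3) :
    (fun x => localField T y x l) ∈ shapeSpace T := by
  have : (fun x => localField T y x l) ∘ refMap T =
      ∑ e ∈ edges, y e.1 e.2 l • (shapeFun T e.1 e.2 ∘ refMap T) := by
    ext x
    simp [localField, Finset.sum_apply, mul_comm]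
  change _ ∈ refSpace
  rw [this]
  exact Submodule.sum_mem _ fun e he => Submodule.smul_mem _ _
    (shapeFun_comp_refMap_mem T (mem_edges.1 he))

theorem localField_midpoint (T : Tet) {y : Fin 4 → Fin 4 → E3} (hy : ∀ j k, y j k = y k j)
    {j k : Fin 4} (h : j ≠ k) :
    localField T y (midpoint ℝ (T.points j) (T.points k)) = y j k := by
  wlog hlt : j < k generalizing j k
  · rw [midpoint_comm, hy j k]
    exact this h.symm (lt_of_le_of_ne (not_lt.1 hlt) h.symm)
  rw [localField, Finset.sum_eq_single (j, k)]
  · rw [shapeFun_midpoint T hlt hlt, if_pos rfl, one_smul]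
  · intro e he hne
    rw [shapeFun_midpoint T (mem_edges.1 he) hlt, if_neg hne, zero_smul]
  · exact fun h => absurd (mem_edges.2 hlt) h

theorem hasFDerivAt_localField (T : Tet) (y : Fin 4 → Fin 4 → E3) (x : E3) :
    HasFDerivAt (localField T y)
      (∑ e ∈ edges, (shapeGrad T e.1 e.2 x).smulRight (y e.1 e.2)) x :=
  HasFDerivAt.fun_sum fun e _ => (hasFDerivAt_shapeFun T e.1 e.2 x).smul_const _

/-- The squared Frobenius norm of the derivative of `w`. -/
def gradSq (w : E3 → E3) (x : E3) : ℝ :=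
  ∑ l, inner ℝ (Tetrahedrization.partialDeriv w l x) (Tetrahedrization.partialDeriv w l x)

theorem gradSq_nonneg (w : E3 → E3) (x : E3) : 0 ≤ gradSq w x :=
  Finset.sum_nonneg fun _ _ => real_inner_self_nonneg

theorem continuous_gradSq {w : E3 → E3} (hw : ContDiff ℝ 1 w) : Continuous (gradSq w) := by
  have := hw.continuous_fderiv one_ne_zero
  unfold gradSq Tetrahedrization.partialDeriv
  fun_prop

/-- The constant is `3 · 6 · 16²`: three partial derivatives, six shape functions, and the bound
`16 / R` on their gradients. -/
theorem gradSq_localField_le {T : Tet} {c : E3} {R : ℝ} (hR : 0 < R)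
    (hb : Metric.closedBall c R ⊆ body T) (y : Fin 4 → Fin 4 → E3) {x : E3} (hx : x ∈ body T) :
    gradSq (localField T y) x ≤ 4608 / R ^ 2 * ∑ e ∈ edges, ‖y e.1 e.2‖ ^ 2 := by
  have h1 : ∀ l, ‖Tetrahedrization.partialDeriv (localField T y) l x‖ ≤
      ∑ e ∈ edges, 16 / R * ‖y e.1 e.2‖ := by
    intro l
    rw [Tetrahedrization.partialDeriv, (hasFDerivAt_localField T y x).fderiv]
    simp only [_root_.sum_apply, ContinuousLinearMap.smulRight_apply]
    refine norm_sum_le_of_le _ fun e _ => ?_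
    rw [norm_smul]
    refine mul_le_mul_of_nonneg_right ?_ (norm_nonneg _)
    refine ((shapeGrad T e.1 e.2 x).le_opNorm _).trans ?_
    simpa using norm_shapeGrad_le hR hb e.1 e.2 hx
  have h2 : ∀ l, inner ℝ (Tetrahedrization.partialDeriv (localField T y) l x)
      (Tetrahedrization.partialDeriv (localField T y) l x) ≤
      6 * ∑ e ∈ edges, (16 / R * ‖y e.1 e.2‖) ^ 2 := by
    intro l
    rw [real_inner_self_eq_norm_sq]
    refine (pow_le_pow_left₀ (norm_nonneg _) (h1 l) 2).trans ?_
    have := sq_sum_le_card_mul_sum_sq (s := edges) (f := fun e => 16 / R * ‖y e.1 e.2‖)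
    rw [show edges.card = 6 by decide] at this
    exact_mod_cast this
  refine (Finset.sum_le_sum fun l _ => h2 l).trans (le_of_eq ?_)
  simp only [mul_pow, ← Finset.mul_sum, Finset.sum_const, Finset.card_univ, Fintype.card_fin]
  ring

/-- A field without energy is constant on `T`. -/
theorem eq_of_integral_gradSq_eq_zero {T : Tet} {w : E3 → E3} (hw : ContDiff ℝ 1 w)
    (h0 : ∫ x in body T, gradSq w x = 0) {a b : E3} (ha : a ∈ body T) (hb : b ∈ body T) :
    w a = w b := by
  have hc := continuous_gradSq hw
  have hae : gradSq w =ᵐ[volume.restrict (body T)] 0 :=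
    (integral_eq_zero_iff_of_nonneg (gradSq_nonneg w) (integrableOn_body_of_continuous hc)).1 h0
  have hae' : gradSq w =ᵐ[volume.restrict (interior (body T))] 0 :=
    ae_restrict_of_ae_restrict_of_subset interior_subset hae
  have heq : Set.EqOn (gradSq w) 0 (interior (body T)) :=
    Measure.eqOn_open_of_ae_eq hae' isOpen_interior hc.continuousOn continuousOn_const
  have hcl : body T ⊆ closure (interior (body T)) := by
    rw [(convex_body T).closure_interior_eq_closure_of_nonempty_interior
      (interior_body_nonempty T)]
    exact subset_closure
  have hzero : ∀ x ∈ body T, fderiv ℝ w x = 0 := by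
    intro x hx
    have hg : gradSq w x = 0 :=
      (heq.closure hc continuous_const) (hcl hx)
    rw [gradSq, Finset.sum_eq_zero_iff_of_nonneg fun _ _ => real_inner_self_nonneg] at hg
    ext1 v
    have hv : v = ∑ l, v l • EuclideanSpace.single l (1 : ℝ) := by
      ext m
      simp [Finset.sum_apply, Pi.single_apply]
    rw [hv, map_sum]
    refine Finset.sum_eq_zero fun l _ => ?_
    rw [map_smul]
    have : fderiv ℝ w x (EuclideanSpace.single l 1) = 0 :=
      inner_self_eq_zero.1 (hg l (Finset.mem_univ l))
    rw [this, smul_zero]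
  have := (convex_body T).norm_image_sub_le_of_norm_fderiv_le (𝕜 := ℝ) (f := w) (C := 0)
    (fun x _ => hw.differentiable one_ne_zero x) (fun x hx => by rw [hzero x hx, norm_zero])
    ha hb
  rw [zero_mul] at this
  exact (sub_eq_zero.1 (norm_le_zero_iff.1 this)).symm

/-! ### Pressures on one tetrahedron -/

/-- The linear part of an affine function. -/
def affGrad (g : E3 →ᵃ[ℝ] ℝ) : E3 →L[ℝ] ℝ := LinearMap.toContinuousLinearMap g.linear

theorem affGrad_sub (g : E3 →ᵃ[ℝ] ℝ) (x y : E3) : affGrad g (x - y) = g x - g y :=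
  g.linearMap_vsub x y

theorem hasFDerivAt_affine (g : E3 →ᵃ[ℝ] ℝ) (x : E3) : HasFDerivAt g (affGrad g) x := by
  have h : (g : E3 → ℝ) = fun y => affGrad g y + g 0 := by
    ext y
    have := affGrad_sub g y 0
    rw [sub_zero] at this
    rw [this, sub_add_cancel]
  rw [h]
  exact (affGrad g).hasFDerivAt.add_const _

theorem contDiff_affine (g : E3 →ᵃ[ℝ] ℝ) {n : WithTop ℕ∞} : ContDiff ℝ n g := by
  have h : (g : E3 → ℝ) = fun y => affGrad g y + g 0 := by
    ext y
    have := affGrad_sub g y 0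
    rw [sub_zero] at this
    rw [this, sub_add_cancel]
  rw [h]
  fun_prop

/-- The contribution of one tetrahedron to `b(v, q)`: integration by parts leaves
`-(v, ∇q)_T`, which is evaluated by the quadrature rule at the edge midpoints. -/
theorem local_form_eq (T : Tet) (y : Fin 4 → Fin 4 → E3) {q : E3 → ℝ} {g : E3 →ᵃ[ℝ] ℝ}
    (hq : ∀ x ∈ body T, q x = g x) :
    (∫ x in body T, Tetrahedrization.divergence (localField T y) x * q x) -
      boundaryFlux T (localField T y) q =
      -(volume.real (body T) / 6 * ∑ e ∈ edges, affGrad g (y e.1 e.2)) := by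
  set w := localField T y with hw
  have hwC : ContDiff ℝ 1 w := contDiff_localField T y
  have hgC : ContDiff ℝ 1 g := contDiff_affine g
  have hF : ContDiff ℝ 1 (fun x => g x • w x) := hgC.smul hwC
  have hd := hwC.continuous_fderiv one_ne_zero
  have hwc := hwC.continuous
  have hgc := hgC.continuous
  have e1 : ∫ x in body T, Tetrahedrization.divergence w x * q x =
      ∫ x in body T, Tetrahedrization.divergence w x * g x :=
    setIntegral_congr_fun (isCompact_body T).measurableSet fun x hx => by
      simp only [hq x hx]
  have e2 : boundaryFlux T w q =
      ∫ x in body T, Tetrahedrization.divergence (fun x => g x • w x) x := by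
    rw [integral_divergence T hF, boundaryFlux_eq]
    congr 1
    refine Finset.sum_congr rfl fun m _ => paramIntegral_congr fun x hx => ?_
    rw [hq x]
    refine convexHull_mono ?_ hx
    rintro z (rfl | rfl | rfl) <;> exact ⟨_, rfl⟩
  have e3 : ∀ x, Tetrahedrization.divergence (fun x => g x • w x) x =
      Tetrahedrization.divergence w x * g x + affGrad g (w x) := by
    intro x
    have := (hasFDerivAt_affine g x).fun_smul (hwC.differentiable one_ne_zero x).hasFDerivAt
    simp only [Tetrahedrization.divergence, Tetrahedrization.partialDeriv]
    rw [this.fderiv]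
    have hv : w x = ∑ l, w x l • EuclideanSpace.single l (1 : ℝ) := by
      ext m
      simp [Finset.sum_apply, Pi.single_apply]
    have : affGrad g (w x) = ∑ l, w x l * affGrad g (EuclideanSpace.single l 1) := by
      conv_lhs => rw [hv]
      simp
    rw [this]
    simp [Fin.sum_univ_three]
    ring
  have e4 : ∫ x in body T, affGrad g (w x) =
      volume.real (body T) / 6 * ∑ e ∈ edges, affGrad g (y e.1 e.2) := by
    simp only [hw, localField, map_sum, map_smul, smul_eq_mul]
    rw [integral_finsetSum _ fun e _ => integrableOn_body_of_continuous (by fun_prop),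
      Finset.mul_sum]
    refine Finset.sum_congr rfl fun e he => ?_
    rw [integral_mul_const, integral_shapeFun T (mem_edges.1 he)]
  rw [e1, e2]
  simp only [e3]
  rw [integral_add, e4]
  · ring
  · refine integrableOn_body_of_continuous ?_
    unfold Tetrahedrization.divergence Tetrahedrization.partialDeriv
    fun_prop
  · exact integrableOn_body_of_continuous (by fun_prop)

theorem norm_affGrad_sq_le {T : Tet} {c : E3} {R : ℝ} (hR : 0 < R)
    (hb : Metric.closedBall c R ⊆ body T) (g : E3 →ᵃ[ℝ] ℝ) :
    ‖affGrad g‖ ^ 2 ≤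
      4 / R ^ 2 * ∑ e ∈ edges, (g (T.points e.2) - g (T.points e.1)) ^ 2 := by
  have hA : affGrad g = ∑ j, (g (T.points j) - g (T.points 0)) • baryGrad T j := by
    ext1 w
    conv_lhs => rw [← sum_baryGrad_smul T 0 w]
    simp [affGrad_sub, mul_comm]
  have h1 : ‖affGrad g‖ ≤ ∑ j, |g (T.points j) - g (T.points 0)| * (1 / R) := by
    rw [hA]
    refine norm_sum_le_of_le _ fun j _ => ?_
    rw [norm_smul, Real.norm_eq_abs]
    exact mul_le_mul_of_nonneg_left (norm_baryGrad_le hR hb j) (abs_nonneg _)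
  refine (pow_le_pow_left₀ (norm_nonneg _) h1 2).trans ?_
  have h2 := sq_sum_le_card_mul_sum_sq (s := Finset.univ)
    (f := fun j => |g (T.points j) - g (T.points 0)| * (1 / R))
  refine h2.trans ?_
  simp only [mul_pow, sq_abs, ← Finset.sum_mul, Finset.card_univ, Fintype.card_fin]
  have h3 : ∑ j, (g (T.points j) - g (T.points 0)) ^ 2 ≤
      ∑ e ∈ edges, (g (T.points e.2) - g (T.points e.1)) ^ 2 := by
    rw [sum_edges, Fin.sum_univ_four]
    nlinarith [sq_nonneg (g (T.points 2) - g (T.points 1)),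
      sq_nonneg (g (T.points 3) - g (T.points 1)), sq_nonneg (g (T.points 3) - g (T.points 2))]
  calc _ = 4 / R ^ 2 * ∑ j, (g (T.points j) - g (T.points 0)) ^ 2 := by push_cast; ring
    _ ≤ _ := by gcongr

theorem norm_gradient_eq {T : Tet} {q : E3 → ℝ} {g : E3 →ᵃ[ℝ] ℝ}
    (hq : ∀ x ∈ body T, q x = g x) {x : E3} (hx : x ∈ interior (body T)) :
    ‖gradient q x‖ = ‖affGrad g‖ := by
  have h : HasFDerivAt q (affGrad g) x :=
    (hasFDerivAt_affine g x).congr_of_eventuallyEq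
      (Filter.eventually_of_mem (mem_interior_iff_mem_nhds.1 hx) hq)
  rw [gradient, h.fderiv, LinearIsometryEquiv.norm_map]

/-! ### Faces and edges of conforming meshes -/

/-- A vertex whose barycentric coordinate does not vanish at a point is needed to span it. -/
theorem vertex_mem_of_bary_ne_zero {T : Tet} {S : Set E3} (hS : S ⊆ Set.range T.points) {x : E3}
    (hx : x ∈ convexHull ℝ S) {j : Fin 4} (h : bary T j x ≠ 0) : T.points j ∈ S := by
  by_contra hj
  apply h
  have hc : Convex ℝ (bary T j ⁻¹' {0}) := (convex_singleton (0 : ℝ)).affine_preimage (bary T j)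
  refine convexHull_min (fun y hy => ?_) hc hx
  obtain ⟨k, rfl⟩ := hS hy
  have : j ≠ k := by rintro rfl; exact hj hy
  simp [bary_vertex, this]

theorem bary_midpoint_left {T : Tet} {j k : Fin 4} (h : j ≠ k) :
    bary T j (midpoint ℝ (T.points j) (T.points k)) = 1 / 2 := by
  rw [bary_midpoint, if_pos rfl, if_neg h, add_zero]

namespace Tetrahedrization

variable {Ω : Set E3} (M : Tetrahedrization Ω)

theorem onBoundary_comm (i : Fin M.card) (j k : Fin 4) :
    M.OnBoundary i j k ↔ M.OnBoundary i k j := by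
  simp only [OnBoundary, edge, segment_symm ℝ (M.vertex i j)]

theorem edgeMid_mem_edge (i : Fin M.card) (j k : Fin 4) : M.edgeMid i j k ∈ M.edge i j k :=
  midpoint_mem_segment _ _

theorem edge_subset_body (i : Fin M.card) (j k : Fin 4) : M.edge i j k ⊆ body (M.tet i) :=
  (convex_body _).segment_subset (vertex_mem_body _ j) (vertex_mem_body _ k)

/-- A boundary edge belongs to a boundary face of some tetrahedron. Since that tetrahedron has three
interior edges, all the edges issuing from the vertex opposite to this face are interior. -/
theorem exists_interior_path (h3 : M.ThreeInteriorEdges) {i : Fin M.card} {j k : Fin 4}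
    (hjk : j ≠ k) (hb : M.OnBoundary i j k) :
    ∃ i' j' k' l, M.vertex i' j' = M.vertex i j ∧ M.vertex i' k' = M.vertex i k ∧ j' ≠ l ∧ k' ≠ l ∧
      ¬ M.OnBoundary i' j' l ∧ ¬ M.OnBoundary i' k' l := by
  have hmid : M.edgeMid i j k ∈ frontier Ω := hb (M.edgeMid_mem_edge i j k)
  rw [M.frontier_eq] at hmid
  simp only [Set.mem_iUnion] at hmid
  obtain ⟨i', m, hm, hmf⟩ := hmid
  have hface : face (M.tet i') m ⊆ frontier Ω := by
    rw [M.frontier_eq]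
    exact fun x hx => Set.mem_iUnion.2 ⟨i', Set.mem_iUnion.2 ⟨m, Set.mem_iUnion.2 ⟨hm, hx⟩⟩⟩
  have hsub : (M.tet i').points '' {m}ᶜ ⊆ Set.range (M.tet i').points := Set.image_subset_range _ _
  have hcommon : M.edgeMid i j k ∈
      convexHull ℝ (Set.range (M.tet i).points ∩ Set.range (M.tet i').points) := by
    rw [← M.conforming]
    exact ⟨M.edge_subset_body i j k (M.edgeMid_mem_edge i j k), convexHull_mono hsub hmf⟩
  have hmj : bary (M.tet i) j (M.edgeMid i j k) = 1 / 2 := bary_midpoint_left hjk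
  have hmk : bary (M.tet i) k (M.edgeMid i j k) = 1 / 2 := by
    rw [edgeMid, midpoint_comm]
    exact bary_midpoint_left hjk.symm
  -- The edge `j k` is spanned by common vertices, so it is an edge of tetrahedron `i'` too.
  obtain ⟨j', hj'⟩ := (vertex_mem_of_bary_ne_zero Set.inter_subset_left hcommon
    (by rw [hmj]; norm_num)).2
  obtain ⟨k', hk'⟩ := (vertex_mem_of_bary_ne_zero Set.inter_subset_left hcommon
    (by rw [hmk]; norm_num)).2
  have hjk' : j' ≠ k' := by
    rintro rfl
    exact hjk ((M.tet i).independent.injective (hj'.symm.trans hk'))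
  have hmid' : M.edgeMid i j k = midpoint ℝ ((M.tet i').points j') ((M.tet i').points k') := by
    rw [hj', hk']
    rfl
  rw [hmid'] at hmf
  have ne_of_mem : ∀ {n : Fin 4}, (M.tet i').points n ∈ (M.tet i').points '' {m}ᶜ → n ≠ m := by
    rintro n ⟨n', hn', he⟩
    rw [← (M.tet i').independent.injective he]
    exact hn'
  have hj'm : j' ≠ m := ne_of_mem (vertex_mem_of_bary_ne_zero hsub hmf
    (by rw [bary_midpoint_left hjk']; norm_num))
  have hk'm : k' ≠ m := ne_of_mem (vertex_mem_of_bary_ne_zero hsub hmf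
    (by rw [midpoint_comm, bary_midpoint_left hjk'.symm]; norm_num))
  have hbd : ∀ a b, a ≠ m → b ≠ m → M.OnBoundary i' a b := fun a b ha hb =>
    ((convex_convexHull ℝ _).segment_subset
      (subset_convexHull ℝ _ (Set.mem_image_of_mem (M.tet i').points ha))
      (subset_convexHull ℝ _ (Set.mem_image_of_mem (M.tet i').points hb))).trans hface
  -- The edges at vertex `m` are the only ones that can be interior, and there are three of them.
  let A : Finset (Fin 4 × Fin 4) :=
    Finset.univ.filter fun e => e.1 < e.2 ∧ (e.1 = m ∨ e.2 = m)
  have hA : A.card = 3 := by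
    have : ∀ m : Fin 4, (Finset.univ.filter fun e : Fin 4 × Fin 4 =>
      e.1 < e.2 ∧ (e.1 = m ∨ e.2 = m)).card = 3 := by decide
    exact this m
  have hIA : {e : Fin 4 × Fin 4 | e.1 < e.2 ∧ ¬ M.OnBoundary i' e.1 e.2} ⊆ A := by
    rintro ⟨a, b⟩ ⟨hab, hnb⟩
    simp only [A, Finset.coe_filter, Finset.mem_univ, true_and, Set.mem_ofPred_eq]
    refine ⟨hab, ?_⟩
    by_contra hc
    push Not at hc
    exact hnb (hbd a b hc.1 hc.2)
  have hEq := Set.eq_of_subset_of_ncard_le hIA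
    (by rw [Set.ncard_coe_finset, hA]; exact h3 i') (Set.toFinite _)
  have hint : ∀ n, n ≠ m → ¬ M.OnBoundary i' n m := by
    intro n hn
    rcases lt_or_gt_of_ne hn with hlt | hlt
    · have : (n, m) ∈ (A : Set (Fin 4 × Fin 4)) := by simp [A, hlt]
      rw [← hEq] at this
      exact this.2
    · have : (m, n) ∈ (A : Set (Fin 4 × Fin 4)) := by simp [A, hlt]
      rw [← hEq] at this
      rw [onBoundary_comm]
      exact this.2
  exact ⟨i', j', k', m, hj', hk', hj'm, hk'm, hint j' hj'm, hint k' hk'm⟩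

/-! ### Discrete velocities -/

open Classical in
/-- The values on the edge midpoints of tetrahedron `i` that are prescribed by `y` on interior edges
and vanish on boundary edges. -/
def edgeValue (y : E3 → E3 → E3) (i : Fin M.card) (j k : Fin 4) : E3 :=
  if M.OnBoundary i j k then 0 else y (M.vertex i j) (M.vertex i k)

/-- The discrete velocity with value `y a b` at the midpoint of each interior edge `a b`. -/
def edgeField (y : E3 → E3 → E3) (i : Fin M.card) : E3 → E3 :=
  localField (M.tet i) (M.edgeValue y i)

theorem edgeValue_comm {y : E3 → E3 → E3} (hy : ∀ a b, y a b = y b a) (i : Fin M.card)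
    (j k : Fin 4) : M.edgeValue y i j k = M.edgeValue y i k j := by
  classical
  rw [edgeValue, edgeValue, hy (M.vertex i j)]
  exact if_congr (M.onBoundary_comm i j k) rfl rfl

theorem edgeField_edgeMid {y : E3 → E3 → E3} (hy : ∀ a b, y a b = y b a) {i : Fin M.card}
    {j k : Fin 4} (h : j ≠ k) : M.edgeField y i (M.edgeMid i j k) = M.edgeValue y i j k :=
  localField_midpoint _ (M.edgeValue_comm hy i) h

theorem edgeField_mem_Wh {y : E3 → E3 → E3} (hy : ∀ a b, y a b = y b a) :
    M.edgeField y ∈ M.Wh := by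
  refine ⟨fun l => ⟨fun i => localField_mem_shapeSpace _ _ l, ?_⟩, ?_⟩
  · intro i i' j k j' k' hjk hj hk hb
    have hjk' : j' ≠ k' := by
      rintro rfl
      exact hjk ((M.tet i).independent.injective (hj.trans hk.symm))
    have hb' : ¬ M.OnBoundary i' j' k' := by
      simpa only [OnBoundary, edge, ← hj, ← hk] using hb
    have hm : M.edgeMid i j k = M.edgeMid i' j' k' := by simp only [edgeMid, hj, hk]
    simp only
    rw [M.edgeField_edgeMid hy hjk, hm, M.edgeField_edgeMid hy hjk', edgeValue, edgeValue,
      if_neg hb, if_neg hb', hj, hk]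
  · intro i j k hjk hb
    rw [M.edgeField_edgeMid hy hjk, edgeValue, if_pos hb]

theorem ah_self (v : Fin M.card → E3 → E3) :
    M.ah v v = ∑ i, ∫ x in body (M.tet i), gradSq (v i) x := rfl

theorem ah_self_nonneg (v : Fin M.card → E3 → E3) : 0 ≤ M.ah v v :=
  Finset.sum_nonneg fun _ _ => integral_nonneg fun _ => gradSq_nonneg _ _

/-- Without energy, the values at the edge midpoints of each tetrahedron agree. -/
theorem edgeValue_eq_of_ahNorm_eq_zero {y : E3 → E3 → E3} (hy : ∀ a b, y a b = y b a)
    (h0 : M.ahNorm (M.edgeField y) = 0) (i : Fin M.card) {j k j' k' : Fin 4} (h : j ≠ k)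
    (h' : j' ≠ k') : M.edgeValue y i j k = M.edgeValue y i j' k' := by
  rw [ahNorm, Real.sqrt_eq_zero (M.ah_self_nonneg _), ah_self,
    Finset.sum_eq_zero_iff_of_nonneg fun _ _ => integral_nonneg fun _ => gradSq_nonneg _ _] at h0
  rw [← M.edgeField_edgeMid hy h, ← M.edgeField_edgeMid hy h']
  exact eq_of_integral_gradSq_eq_zero (contDiff_localField _ _) (h0 i (Finset.mem_univ i))
    (M.edge_subset_body i j k (M.edgeMid_mem_edge i j k))
    (M.edge_subset_body i j' k' (M.edgeMid_mem_edge i j' k'))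

theorem b_edgeField (y : E3 → E3 → E3) {q : E3 → ℝ} {g : Fin M.card → E3 →ᵃ[ℝ] ℝ}
    (hg : ∀ i, ∀ x ∈ body (M.tet i), q x = g i x) :
    M.b (M.edgeField y) q = -∑ i, volume.real (body (M.tet i)) / 6 *
      ∑ e ∈ edges, affGrad (g i) (M.edgeValue y i e.1 e.2) := by
  rw [b, ← Finset.sum_neg_distrib]
  exact Finset.sum_congr rfl fun i _ => local_form_eq _ _ (hg i)

/-- The supremum is nonnegative: there is a discrete velocity of nonzero norm, supported around a
single interior edge, and its sign is free. -/
theorem exists_mem_Wh_b_nonneg (hΩ : Ω.Nonempty) (h3 : M.ThreeInteriorEdges) {q : E3 → ℝ}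
    (hq : q ∈ M.Qh) : ∃ v ∈ M.Wh, M.ahNorm v ≠ 0 ∧ 0 ≤ M.b v q := by
  choose g hg using hq.2.2
  obtain ⟨x, hx⟩ := hΩ
  have hx' := subset_closure hx
  rw [M.closure_eq, Set.mem_iUnion] at hx'
  obtain ⟨i, -⟩ := hx'
  obtain ⟨⟨j, k⟩, hjk, hb⟩ : {e : Fin 4 × Fin 4 | e.1 < e.2 ∧ ¬ M.OnBoundary i e.1 e.2}.Nonempty :=
    Set.nonempty_of_ncard_ne_zero (by have := h3 i; omega)
  simp only at hjk hb
  classical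
  let y : E3 → E3 → E3 → E3 := fun u a b =>
    if s(a, b) = s(M.vertex i j, M.vertex i k) then u else 0
  have hy : ∀ u a b, y u a b = y u b a := fun u a b => by simp only [y, Sym2.eq_swap]
  obtain ⟨l, hlj, hlk⟩ : ∃ l : Fin 4, j ≠ l ∧ k ≠ l := by
    clear * -
    revert j k; decide
  have hnorm : ∀ u, u ≠ 0 → M.ahNorm (M.edgeField (y u)) ≠ 0 := by
    intro u hu h0
    have h1 := M.edgeValue_eq_of_ahNorm_eq_zero (hy u) h0 i hjk.ne hlj
    have h2 : M.edgeValue (y u) i j k = u := by simp [edgeValue, hb, y]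
    have h4 : M.edgeValue (y u) i j l = 0 := by
      have hinj := (M.tet i).independent.injective
      have : s(M.vertex i j, M.vertex i l) ≠ s(M.vertex i j, M.vertex i k) := by
        intro he
        rw [Sym2.congr_right] at he
        exact hlk (hinj he).symm
      simp only [edgeValue, y, if_neg this, ite_self]
    exact hu (h2.symm.trans (h1.trans h4))
  -- Passing from `u` to `-u` changes the sign of `b`.
  obtain ⟨u, hu⟩ : ∃ u : E3, u ≠ 0 := exists_ne 0
  have hneg : M.b (M.edgeField (y (-u))) q = -M.b (M.edgeField (y u)) q := by
    have : ∀ i j k, M.edgeValue (y (-u)) i j k = -M.edgeValue (y u) i j k := by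
      intro i j k
      simp only [edgeValue, y]
      split_ifs <;> simp
    simp only [M.b_edgeField _ hg, this, map_neg, Finset.sum_neg_distrib, mul_neg]
  rcases le_total 0 (M.b (M.edgeField (y u)) q) with h | h
  · exact ⟨_, M.edgeField_mem_Wh (hy u), hnorm u hu, h⟩
  · exact ⟨_, M.edgeField_mem_Wh (hy (-u)), hnorm _ (neg_ne_zero.2 hu), by rw [hneg]; linarith⟩

/-! ### Shape regularity -/

theorem diam_pos (i : Fin M.card) : 0 < M.diam i :=
  Metric.diam_pos ⟨_, vertex_mem_body _ 0, _, vertex_mem_body _ 1, fun h => by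
    have := (M.tet i).independent.injective h
    exact absurd this (by decide)⟩ (isCompact_body _).isBounded

theorem dist_le_diam {i : Fin M.card} {x y : E3} (hx : x ∈ body (M.tet i))
    (hy : y ∈ body (M.tet i)) : dist x y ≤ M.diam i :=
  Metric.dist_le_diam_of_mem (isCompact_body _).isBounded hx hy

/-- The edges of a shape regular tetrahedron are comparable with its diameter. -/
theorem diam_le_mul_dist {σ : ℝ} (hσ : 0 < σ) (hM : M.ShapeRegular σ) (i : Fin M.card)
    {j k : Fin 4} (h : j ≠ k) : M.diam i ≤ σ * dist (M.vertex i j) (M.vertex i k) := by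
  obtain ⟨c, hc⟩ := hM i
  have hd := M.diam_pos i
  have h1 := (baryGrad (M.tet i) j).le_opNorm (M.vertex i j - M.vertex i k)
  have h2 := norm_baryGrad_le (div_pos hd hσ) hc j
  rw [vertex, vertex, baryGrad_edge, if_pos rfl, if_neg h, sub_zero, norm_one, ← dist_eq_norm] at h1
  have h4 := h1.trans (mul_le_mul_of_nonneg_right h2 dist_nonneg)
  rw [one_div_div, div_mul_eq_mul_div, one_le_div hd] at h4
  exact h4

/-- Tetrahedra `i` and `i'` have a common edge. -/
def ShareEdge (i i' : Fin M.card) : Prop :=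
  ∃ j k j' k', j ≠ k ∧ M.vertex i j = M.vertex i' j' ∧ M.vertex i k = M.vertex i' k'

theorem sum_volume_le (s : Finset (Fin M.card)) {c : E3} {r : ℝ}
    (h : ∀ i ∈ s, body (M.tet i) ⊆ Metric.closedBall c r) :
    ∑ i ∈ s, volume.real (body (M.tet i)) ≤ volume.real (Metric.closedBall c r) := by
  have hi : ∀ i, volume.real (body (M.tet i)) = volume.real (interior (body (M.tet i))) :=
    fun i => measureReal_congr
      (interior_ae_eq_of_null_frontier ((convex_body _).addHaar_frontier volume)).symm
  simp only [hi]
  rw [← measureReal_biUnion_finset (fun i _ j _ hij => M.disjoint_interior i j hij)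
    (fun i _ => isOpen_interior.measurableSet)
    (fun i _ => ((measure_mono interior_subset).trans_lt (isCompact_body _).measure_lt_top).ne)]
  refine measureReal_mono (Set.iUnion₂_subset fun i hi => interior_subset.trans (h i hi)) ?_
  exact (isCompact_closedBall c r).measure_lt_top.ne

open Classical in
/-- The tetrahedra that have an edge in common with a given one occupy a volume comparable with
its own: they do not overlap, and they lie in a ball of comparable radius around it. -/
theorem sum_volume_shareEdge_le {σ : ℝ} (hσ : 0 < σ) (hM : M.ShapeRegular σ) (i' : Fin M.card) :
    ∑ i with M.ShareEdge i i', volume.real (body (M.tet i)) ≤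
      (σ * (1 + σ)) ^ 3 * volume.real (body (M.tet i')) := by
  have hd := M.diam_pos i'
  obtain ⟨c, hc⟩ := hM i'
  have h1 := M.sum_volume_le (Finset.univ.filter fun i => M.ShareEdge i i')
    (c := M.vertex i' 0) (r := (1 + σ) * M.diam i') (by
      intro i hi x hx
      obtain ⟨j, k, j', k', hjk, hj, hk⟩ := (Finset.mem_filter.1 hi).2
      have e1 := M.diam_le_mul_dist hσ hM i hjk
      rw [hj, hk] at e1
      have e2 := M.dist_le_diam (vertex_mem_body (M.tet i') j') (vertex_mem_body (M.tet i') k')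
      have e3 := M.dist_le_diam hx (vertex_mem_body (M.tet i) j)
      have e4 := M.dist_le_diam (vertex_mem_body (M.tet i') j') (vertex_mem_body (M.tet i') 0)
      have e5 := dist_triangle x (M.vertex i j) (M.vertex i' 0)
      have e6 := e1.trans (mul_le_mul_of_nonneg_left e2 hσ.le)
      rw [Metric.mem_closedBall]
      rw [← hj] at e1
      have e7 : dist (M.vertex i j) (M.vertex i' 0) ≤ M.diam i' := by rw [hj]; exact e4
      have e8 : dist x (M.vertex i j) ≤ M.diam i := e3
      linarith)
  have h2 : volume.real (Metric.closedBall c (M.diam i' / σ)) ≤ volume.real (body (M.tet i')) :=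
    measureReal_mono hc (isCompact_body _).measure_lt_top.ne
  refine h1.trans ?_
  rw [Measure.addHaar_real_closedBall _ _ (by positivity)] at h2 ⊢
  have hf : Module.finrank ℝ E3 = 3 := by simp
  rw [hf] at h2 ⊢
  calc _ = (σ * (1 + σ)) ^ 3 * ((M.diam i' / σ) ^ 3 * volume.real (Metric.ball (0 : E3) 1)) := by
        field_simp
    _ ≤ _ := by gcongr

/-! ### Differences of the pressure along edges -/

/-- The sum of the squared differences of `q` over the edges of tetrahedron `i`. -/
def diffSum (q : E3 → ℝ) (i : Fin M.card) : ℝ :=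
  ∑ e ∈ edges, (q (M.vertex i e.2) - q (M.vertex i e.1)) ^ 2

open Classical in
/-- The sum of the squared differences of `q` over the interior edges of tetrahedron `i`. -/
def interiorDiffSum (q : E3 → ℝ) (i : Fin M.card) : ℝ :=
  ∑ e ∈ edges, if M.OnBoundary i e.1 e.2 then 0 else (q (M.vertex i e.2) - q (M.vertex i e.1)) ^ 2

theorem interiorDiffSum_nonneg (q : E3 → ℝ) (i : Fin M.card) : 0 ≤ M.interiorDiffSum q i :=
  Finset.sum_nonneg fun e _ => by split_ifs <;> positivity

theorem sq_le_interiorDiffSum (q : E3 → ℝ) {i : Fin M.card} {j k : Fin 4} (hjk : j ≠ k)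
    (hb : ¬ M.OnBoundary i j k) :
    (q (M.vertex i k) - q (M.vertex i j)) ^ 2 ≤ M.interiorDiffSum q i := by
  classical
  wlog hlt : j < k generalizing j k
  · rw [← neg_sub, neg_sq]
    exact this hjk.symm (by rwa [onBoundary_comm]) (lt_of_le_of_ne (not_lt.1 hlt) hjk.symm)
  have := Finset.single_le_sum (s := edges) (f := fun e => if M.OnBoundary i e.1 e.2 then 0 else
    (q (M.vertex i e.2) - q (M.vertex i e.1)) ^ 2) (fun e _ => by split_ifs <;> positivity)
    (mem_edges.2 hlt : (j, k) ∈ edges)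
  simp only [if_neg hb] at this
  exact this

/-- The difference of `q` along any edge is controlled by interior edges of a tetrahedron that
contains this edge. -/
theorem exists_sq_le_interiorDiffSum (h3 : M.ThreeInteriorEdges) (q : E3 → ℝ) (i : Fin M.card)
    {j k : Fin 4} (hjk : j ≠ k) : ∃ i', M.ShareEdge i i' ∧
      (q (M.vertex i k) - q (M.vertex i j)) ^ 2 ≤ 4 * M.interiorDiffSum q i' := by
  by_cases hb : M.OnBoundary i j k
  · obtain ⟨i', j', k', l, hj, hk, hjl, hkl, hbj, hbk⟩ := M.exists_interior_path h3 hjk hb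
    refine ⟨i', ⟨j, k, j', k', hjk, hj.symm, hk.symm⟩, ?_⟩
    have h1 := M.sq_le_interiorDiffSum q hjl hbj
    have h2 := M.sq_le_interiorDiffSum q hkl hbk
    rw [← hj, ← hk]
    nlinarith [sq_nonneg ((q (M.vertex i' l) - q (M.vertex i' k')) +
      (q (M.vertex i' l) - q (M.vertex i' j')))]
  · refine ⟨i, ⟨j, k, j, k, hjk, rfl, rfl⟩, ?_⟩
    have := M.sq_le_interiorDiffSum q hjk hb
    linarith [M.interiorDiffSum_nonneg q i]

theorem sum_diffSum_le {σ : ℝ} (hσ : 0 < σ) (hM : M.ShapeRegular σ) (h3 : M.ThreeInteriorEdges)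
    (q : E3 → ℝ) : ∑ i, volume.real (body (M.tet i)) * M.diffSum q i ≤
      24 * (σ * (1 + σ)) ^ 3 * ∑ i, volume.real (body (M.tet i)) * M.interiorDiffSum q i := by
  classical
  have h1 : ∀ i, M.diffSum q i ≤
      24 * ∑ i', if M.ShareEdge i i' then M.interiorDiffSum q i' else 0 := by
    intro i
    have : ∀ e ∈ edges, (q (M.vertex i e.2) - q (M.vertex i e.1)) ^ 2 ≤
        4 * ∑ i', if M.ShareEdge i i' then M.interiorDiffSum q i' else 0 := by
      intro e he
      obtain ⟨i', hs, hle⟩ := M.exists_sq_le_interiorDiffSum h3 q i (mem_edges.1 he).ne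
      refine hle.trans (mul_le_mul_of_nonneg_left ?_ (by norm_num))
      have := Finset.single_le_sum (s := Finset.univ)
        (f := fun i' => if M.ShareEdge i i' then M.interiorDiffSum q i' else 0)
        (fun i' _ => by split_ifs; exacts [M.interiorDiffSum_nonneg q i', le_rfl])
        (Finset.mem_univ i')
      simpa only [if_pos hs] using this
    refine (Finset.sum_le_card_nsmul _ _ _ this).trans (le_of_eq ?_)
    rw [show edges.card = 6 by decide, nsmul_eq_mul]
    push_cast
    ring
  calc ∑ i, volume.real (body (M.tet i)) * M.diffSum q i
      ≤ ∑ i, volume.real (body (M.tet i)) *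
        (24 * ∑ i', if M.ShareEdge i i' then M.interiorDiffSum q i' else 0) :=
        Finset.sum_le_sum fun i _ => mul_le_mul_of_nonneg_left (h1 i) measureReal_nonneg
    _ = 24 * ∑ i', (∑ i with M.ShareEdge i i', volume.real (body (M.tet i))) *
        M.interiorDiffSum q i' := by
        simp only [Finset.mul_sum, Finset.sum_mul, Finset.sum_filter]
        rw [Finset.sum_comm]
        refine Finset.sum_congr rfl fun i' _ => Finset.sum_congr rfl fun i _ => ?_
        split_ifs <;> ring
    _ ≤ 24 * ∑ i', (σ * (1 + σ)) ^ 3 * volume.real (body (M.tet i')) *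
        M.interiorDiffSum q i' := by
        gcongr with i'
        · exact M.interiorDiffSum_nonneg q i'
        · exact M.sum_volume_shareEdge_le hσ hM i'
    _ = _ := by
        simp only [Finset.mul_sum]
        refine Finset.sum_congr rfl fun i' _ => ?_
        ring

/-- Almost every point of `Ω` is interior to a tetrahedron, where `q` is affine. -/
theorem gradNorm_sq_le {q : E3 → ℝ} {g : Fin M.card → E3 →ᵃ[ℝ] ℝ}
    (hg : ∀ i, ∀ x ∈ body (M.tet i), q x = g i x) :
    gradNorm Ω q ^ 2 ≤ ∑ i, volume.real (body (M.tet i)) * ‖affGrad (g i)‖ ^ 2 := by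
  rw [gradNorm, Real.sq_sqrt (integral_nonneg fun _ => by positivity)]
  have hm : ∀ i, MeasurableSet (interior (body (M.tet i))) := fun i => isOpen_interior.measurableSet
  have hfin : ∀ i, volume (interior (body (M.tet i))) ≠ ⊤ := fun i =>
    ((measure_mono interior_subset).trans_lt (isCompact_body _).measure_lt_top).ne
  have hcongr : ∀ i, Set.EqOn (fun _ => ‖affGrad (g i)‖ ^ 2) (fun x => ‖gradient q x‖ ^ 2)
      (interior (body (M.tet i))) := fun i x hx => by
    simp only [norm_gradient_eq (hg i) hx]
  have hint : ∀ i, IntegrableOn (fun x => ‖gradient q x‖ ^ 2) (interior (body (M.tet i))) := fun i =>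
    (integrableOn_const (hfin i)).congr_fun (hcongr i) (hm i)
  have hsub : Ω ≤ᵐ[volume] ⋃ i, interior (body (M.tet i)) := by
    have hae : ∀ᵐ x : E3, ∀ i, x ∉ frontier (body (M.tet i)) :=
      ae_all_iff.2 fun i => measure_eq_zero_iff_ae_notMem.1 ((convex_body _).addHaar_frontier volume)
    filter_upwards [hae] with x hx hxΩ
    have hx' := subset_closure hxΩ
    rw [M.closure_eq, Set.mem_iUnion] at hx'
    obtain ⟨i, hi⟩ := hx'
    refine Set.mem_iUnion.2 ⟨i, ?_⟩
    by_contra hni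
    exact hx i ⟨subset_closure hi, hni⟩
  refine (setIntegral_mono_set (integrableOn_finite_iUnion.2 hint)
    (Filter.Eventually.of_forall fun _ => by positivity) hsub).trans ?_
  rw [integral_iUnion_fintype hm (fun i j hij => M.disjoint_interior i j hij) hint]
  refine Finset.sum_le_sum fun i _ => ?_
  rw [← setIntegral_congr_fun (hm i) (hcongr i), setIntegral_const, smul_eq_mul]
  gcongr
  · exact (isCompact_body _).measure_lt_top.ne
  · exact interior_subset

/-! ### The inf-sup condition -/

/-- The velocity at the midpoint of the edge `a b` that tests the tangential derivative of `q`. -/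
def tangentValue (q : E3 → ℝ) (a b : E3) : E3 := -((q b - q a) • (b - a))

theorem tangentValue_comm (q : E3 → ℝ) (a b : E3) : tangentValue q a b = tangentValue q b a := by
  simp only [tangentValue]
  module

/-- The velocity `-(q(b) - q(a)) (b - a)` turns each interior edge into a square. -/
theorem b_tangent {q : E3 → ℝ} {g : Fin M.card → E3 →ᵃ[ℝ] ℝ}
    (hg : ∀ i, ∀ x ∈ body (M.tet i), q x = g i x) :
    M.b (M.edgeField (tangentValue q)) q =
      (∑ i, volume.real (body (M.tet i)) * M.interiorDiffSum q i) / 6 := by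
  classical
  rw [M.b_edgeField _ hg, Finset.sum_div, ← Finset.sum_neg_distrib]
  refine Finset.sum_congr rfl fun i _ => ?_
  have : ∀ e : Fin 4 × Fin 4, affGrad (g i) (M.edgeValue (tangentValue q) i e.1 e.2) =
      -(if M.OnBoundary i e.1 e.2 then 0 else
        (q (M.vertex i e.2) - q (M.vertex i e.1)) ^ 2) := by
    intro e
    rw [edgeValue]
    split_ifs
    · simp
    · have h1 := hg i _ (vertex_mem_body (M.tet i) e.1)
      have h2 := hg i _ (vertex_mem_body (M.tet i) e.2)
      rw [tangentValue, map_neg, map_smul, affGrad_sub, vertex, vertex, ← h1, ← h2, smul_eq_mul, sq]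
  simp only [this, Finset.sum_neg_distrib, interiorDiffSum]
  ring

theorem ah_tangent_le {σ : ℝ} (hσ : 0 < σ) (hM : M.ShapeRegular σ) (q : E3 → ℝ) :
    M.ah (M.edgeField (tangentValue q)) (M.edgeField (tangentValue q)) ≤
      4608 * σ ^ 2 * ∑ i, volume.real (body (M.tet i)) * M.interiorDiffSum q i := by
  classical
  rw [ah_self, Finset.mul_sum]
  refine Finset.sum_le_sum fun i _ => ?_
  obtain ⟨c, hc⟩ := hM i
  have hd := M.diam_pos i
  have h1 : ∀ e ∈ edges, ‖M.edgeValue (tangentValue q) i e.1 e.2‖ ^ 2 ≤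
      M.diam i ^ 2 * if M.OnBoundary i e.1 e.2 then 0 else
        (q (M.vertex i e.2) - q (M.vertex i e.1)) ^ 2 := by
    intro e _
    rw [edgeValue]
    split_ifs
    · simp
    · rw [tangentValue, norm_neg, norm_smul, mul_pow, Real.norm_eq_abs, sq_abs, ← dist_eq_norm,
        mul_comm]
      gcongr
      exact M.dist_le_diam (vertex_mem_body _ _) (vertex_mem_body _ _)
  have h2 : ∀ x ∈ body (M.tet i), gradSq (M.edgeField (tangentValue q) i) x ≤
      4608 * σ ^ 2 * M.interiorDiffSum q i := by
    intro x hx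
    refine (gradSq_localField_le (div_pos hd hσ) hc _ hx).trans ?_
    refine (mul_le_mul_of_nonneg_left (Finset.sum_le_sum h1) (by positivity)).trans (le_of_eq ?_)
    rw [← Finset.mul_sum, ← interiorDiffSum]
    field_simp
  have h4 := setIntegral_mono_on
    (integrableOn_body_of_continuous (continuous_gradSq
      (contDiff_localField (M.tet i) (M.edgeValue (tangentValue q) i))))
    (integrableOn_const (isCompact_body (M.tet i)).measure_lt_top.ne)
    (isCompact_body (M.tet i)).measurableSet h2
  rw [setIntegral_const, smul_eq_mul] at h4
  refine h4.trans (le_of_eq ?_)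
  ring

/-- If the test velocity has no energy, then it vanishes at all edge midpoints, because two
different edges of a tetrahedron are not parallel. -/
theorem interiorDiffSum_eq_zero {q : E3 → ℝ} (h0 : M.ahNorm (M.edgeField (tangentValue q)) = 0)
    (i : Fin M.card) : M.interiorDiffSum q i = 0 := by
  refine Finset.sum_eq_zero fun e he => ?_
  obtain ⟨j, k⟩ := e
  have hjk : j ≠ k := (mem_edges.1 he).ne
  simp only
  split_ifs with hb
  · rfl
  obtain ⟨l, hlj, hlk⟩ : ∃ l : Fin 4, j ≠ l ∧ k ≠ l := by
    clear * -
    revert j k; decide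
  have h1 := M.edgeValue_eq_of_ahNorm_eq_zero (tangentValue_comm q) h0 i hjk hlj
  have h2 := congrArg (baryGrad (M.tet i) k) h1
  have h4 : baryGrad (M.tet i) k (M.edgeValue (tangentValue q) i j l) = 0 := by
    rw [edgeValue]
    split_ifs
    · simp
    · simp [tangentValue, vertex, baryGrad_edge, hlk, hjk.symm]
  rw [h4, edgeValue, if_neg hb, tangentValue, map_neg, map_smul, vertex, vertex, baryGrad_edge,
    if_pos rfl, if_neg hjk.symm] at h2
  rw [← neg_sub, neg_sq]
  simpa [vertex, sub_eq_zero] using h2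

theorem gradNorm_le {σ κ h : ℝ} (hσ : 0 < σ) (hκ : 0 < κ) (hM : M.ShapeRegular σ)
    (h3 : M.ThreeInteriorEdges) (hpos : 0 < h) (hh : ∀ i, h ≤ κ * M.diam i) {q : E3 → ℝ}
    {g : Fin M.card → E3 →ᵃ[ℝ] ℝ} (hg : ∀ i, ∀ x ∈ body (M.tet i), q x = g i x) :
    (h * gradNorm Ω q) ^ 2 ≤ 96 * (κ * σ) ^ 2 * (σ * (1 + σ)) ^ 3 *
      ∑ i, volume.real (body (M.tet i)) * M.interiorDiffSum q i := by
  have h1 : ∀ i, h ^ 2 * ‖affGrad (g i)‖ ^ 2 ≤ 4 * (κ * σ) ^ 2 * M.diffSum q i := by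
    intro i
    obtain ⟨c, hc⟩ := hM i
    have hd := M.diam_pos i
    have e1 := norm_affGrad_sq_le (div_pos hd hσ) hc (g i)
    have e2 : ∑ e ∈ edges, (g i ((M.tet i).points e.2) - g i ((M.tet i).points e.1)) ^ 2 =
        M.diffSum q i := by
      refine Finset.sum_congr rfl fun e _ => ?_
      rw [← hg i _ (vertex_mem_body _ _), ← hg i _ (vertex_mem_body _ _)]
      rfl
    rw [e2] at e1
    have e4 : 0 ≤ M.diffSum q i := Finset.sum_nonneg fun _ _ => sq_nonneg _
    calc h ^ 2 * ‖affGrad (g i)‖ ^ 2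
        ≤ (κ * M.diam i) ^ 2 * (4 / (M.diam i / σ) ^ 2 * M.diffSum q i) := by
          gcongr
          exact hh i
      _ = _ := by field_simp
  calc (h * gradNorm Ω q) ^ 2 = h ^ 2 * gradNorm Ω q ^ 2 := by ring
    _ ≤ h ^ 2 * ∑ i, volume.real (body (M.tet i)) * ‖affGrad (g i)‖ ^ 2 := by
        gcongr
        exact M.gradNorm_sq_le hg
    _ = ∑ i, volume.real (body (M.tet i)) * (h ^ 2 * ‖affGrad (g i)‖ ^ 2) := by
        rw [Finset.mul_sum]
        exact Finset.sum_congr rfl fun i _ => by ring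
    _ ≤ ∑ i, volume.real (body (M.tet i)) * (4 * (κ * σ) ^ 2 * M.diffSum q i) :=
        Finset.sum_le_sum fun i _ => mul_le_mul_of_nonneg_left (h1 i) measureReal_nonneg
    _ = 4 * (κ * σ) ^ 2 * ∑ i, volume.real (body (M.tet i)) * M.diffSum q i := by
        rw [Finset.mul_sum]
        exact Finset.sum_congr rfl fun i _ => by ring
    _ ≤ 4 * (κ * σ) ^ 2 * (24 * (σ * (1 + σ)) ^ 3 *
        ∑ i, volume.real (body (M.tet i)) * M.interiorDiffSum q i) := by
        gcongr
        exact M.sum_diffSum_le hσ hM h3 q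
    _ = _ := by ring

end Tetrahedrization

end RotatedQ1

end

theorem mainTheorem3 (σ κ : ℝ) (hσ : 0 < σ) (hκ : 0 < κ) :
    ∃ c₃ : ℝ, 0 < c₃ ∧
      ∀ (Ω : Set RotatedQ1.E3) (M : RotatedQ1.Tetrahedrization Ω) (h : ℝ),
        Ω.Nonempty → M.ShapeRegular σ → 0 < h → (∀ i, h ≤ κ * M.diam i) → M.ThreeInteriorEdges →
          ∀ q ∈ M.Qh,
            ((c₃ * h * RotatedQ1.gradNorm Ω q : ℝ) : EReal) ≤
              ⨆ v ∈ {v | v ∈ M.Wh ∧ M.ahNorm v ≠ 0}, ((M.b v q / M.ahNorm v : ℝ) : EReal) := by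
  set B : ℝ := 96 * (κ * σ) ^ 2 * (σ * (1 + σ)) ^ 3 with hB
  set A : ℝ := 4608 * σ ^ 2 with hA
  have hBpos : 0 < B := by positivity
  have hApos : 0 < A := by positivity
  refine ⟨1 / (6 * √A * √B), by positivity, fun Ω M h hΩ hM hpos hh h3 q hq => ?_⟩
  choose g hg using hq.2.2
  set S := ∑ i, volume.real (RotatedQ1.body (M.tet i)) * M.interiorDiffSum q i with hS
  have hgrad := M.gradNorm_le hσ hκ hM h3 hpos hh hg
  rw [← hB, ← hS] at hgrad
  have hS0 : 0 ≤ S :=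
    Finset.sum_nonneg fun i _ => mul_nonneg measureReal_nonneg (M.interiorDiffSum_nonneg q i)
  have hgrad' : h * RotatedQ1.gradNorm Ω q ≤ √B * √S := by
    rw [← Real.sqrt_mul hBpos.le]
    exact Real.le_sqrt_of_sq_le hgrad
  obtain ⟨v, hv, hle⟩ : ∃ v, (v ∈ M.Wh ∧ M.ahNorm v ≠ 0) ∧
      1 / (6 * √A * √B) * h * RotatedQ1.gradNorm Ω q ≤ M.b v q / M.ahNorm v := by
    -- If `S = 0`, then `∇q = 0` and any velocity with `b(v, q) ≥ 0` will do.
    rcases hS0.eq_or_lt with hz | hlt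
    · obtain ⟨v, hv, hn, hb⟩ := M.exists_mem_Wh_b_nonneg hΩ h3 hq
      refine ⟨v, ⟨hv, hn⟩, ?_⟩
      rw [← hz, Real.sqrt_zero, mul_zero] at hgrad'
      refine le_trans ?_ (div_nonneg hb (Real.sqrt_nonneg _))
      rw [mul_assoc]
      exact mul_nonpos_of_nonneg_of_nonpos (by positivity) hgrad'
    · have hn : M.ahNorm (M.edgeField (RotatedQ1.Tetrahedrization.tangentValue q)) ≠ 0 := by
        intro h0
        refine hlt.ne' (Finset.sum_eq_zero fun i _ => ?_)
        rw [M.interiorDiffSum_eq_zero h0, mul_zero]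
      refine ⟨_, ⟨M.edgeField_mem_Wh (RotatedQ1.Tetrahedrization.tangentValue_comm q), hn⟩, ?_⟩
      have hnpos : 0 < M.ahNorm (M.edgeField (RotatedQ1.Tetrahedrization.tangentValue q)) :=
        lt_of_le_of_ne (Real.sqrt_nonneg _) hn.symm
      have hnle : M.ahNorm (M.edgeField (RotatedQ1.Tetrahedrization.tangentValue q)) ≤ √A * √S := by
        rw [← Real.sqrt_mul hApos.le]
        exact Real.sqrt_le_sqrt (M.ah_tangent_le hσ hM q)
      rw [M.b_tangent hg, ← hS]
      have hSs : √S * √S = S := Real.mul_self_sqrt hS0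
      have hSp : 0 < √S := Real.sqrt_pos.2 hlt
      calc 1 / (6 * √A * √B) * h * RotatedQ1.gradNorm Ω q
          = 1 / (6 * √A * √B) * (h * RotatedQ1.gradNorm Ω q) := by ring
        _ ≤ 1 / (6 * √A * √B) * (√B * √S) := by gcongr
        _ = √S * √S / 6 / (√A * √S) := by field_simp
        _ = S / 6 / (√A * √S) := by rw [hSs]
        _ ≤ _ := by gcongr
  exact (EReal.coe_le_coe_iff.2 hle).trans (le_iSup₂_of_le v hv le_rfl)
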